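/- Let $n$ be a positive integer and let $\mathcal{C}$ be an additive and idempotent complete category (not necessarily skeletally small). Let $\operatorname{mod}\mathcal{C}$ be the category of finitely presented right $\mathcal{C}$-modules, i.e. of additive functors $F\colon\mathcal{C}^{\mathrm{op}}\to\mathrm{Ab}$ admitting an exact sequence $\mathcal{C}(-,X)\to\mathcal{C}(-,Y)\to F\to 0$. Call $\mathcal{C}$ coherent if both $\operatorname{mod}\mathcal{C}$ and $\operatorname{mod}\mathcal{C}^{\mathrm{op}}$ are abelian. A sequence $X_n\to\cdots\to X_1\to X$ is an $n$-kernel of $f\colon X\to Y$ if $0\to\mathcal{C}(-,X_n)\to\cdots\to\mathcal{C}(-,X_1)\to\mathcal{C}(-,X)\to\mathcal{C}(-,Y)$ is exact; $n$-cokernels are defined dually. The category $\mathcal{C}$ is $n$-abelian if every morphism has an $n$-kernel and an $n$-cokernel, if for every monomorphism $f\colon X\to Y$ and every $n$-cokernel $Y\xrightarrow{g_1}Y_1\to\cdots\xrightarrow{g_n}Y_n$ of $f$ the sequence $X\xrightarrow{f}Y\xrightarrow{g_1}\cdots\xrightarrow{g_{n-1}}Y_{n-1}$ is an $n$-kernel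 of $g_n$, and if the dual condition for epimorphisms holds. For an abelian category $\mathcal{A}$, let $\operatorname{gldim}\mathcal{A}$ be its global dimension; the dominant dimension of $X\in\mathcal{A}$ is the supremum of the positive integers $m$ for which there is an exact sequence $0\to X\to Y_1\to\cdots\to Y_m$ with all $Y_i$ projective and injective ($0$ if there is none), and $\operatorname{domdim}\mathcal{A}$ is the supremum of the nonnegative integers $m$ such that every projective object of $\mathcal{A}$ has dominant dimension at least $m$. (1) $\mathcal{C}$ is $n$-abelian and has enough injectives if and only if $\mathcal{C}$ is coherent and $\operatorname{gldim}(\operatorname{mod}\mathcal{C})\leq n+1\leq\operatorname{domdim}(\operatorname{mod}\mathcal{C})$. Moreover, in this case, $\operatorname{mod}\mathcal{C}$ has enough injectives. (2) Dually, $\mathcal{C}$ is $n$-abelian and has enough projectives if and only if $\mathcal{C}$ is coherent and $\operatorname{gldim}(\operatorname{mod}\mathcal{C}^{\mathrm{op}})\leq n+1\leq\operatorname{domdim}(\operatorname{mod}\mathcal{C}^{\mathrm{op}})$. Moreover, in this case, $\operatorname{mod}\mathcal{C}^{\mathrm{op}}$ has enough injectives. -/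

import Mathlib

open CategoryTheory CategoryTheory.Limits Opposite

universe u v

namespace HigherAbelian

/-! ### n-kernels, n-cokernels and n-abelian categories -/

section Sequences

variable {C : Type u} [Category.{v} C] [Preadditive C]

/-- For a sequence `S₀ ⟶ S₁ ⟶ ⋯ ⟶ Sₙ ⟶ Sₙ₊₁` in `C`, the assertion that
`0 ⟶ C(-, S₀) ⟶ C(-, S₁) ⟶ ⋯ ⟶ C(-, Sₙ) ⟶ C(-, Sₙ₊₁)` is exact, that is, that the first `n`
arrows form an `n`-kernel of the last arrow `Sₙ ⟶ Sₙ₊₁`. -/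
structure IsNKernel {n : ℕ} (S : ComposableArrows C (n + 1)) : Prop where
  injective (W : C) : Function.Injective (fun a : W ⟶ S.obj' 0 => a ≫ S.map' 0 1)
  exact (i : ℕ) (hi : i + 2 ≤ n + 1) (W : C) :
    Function.Exact (fun a : W ⟶ S.obj' i => a ≫ S.map' i (i + 1))
      (fun a : W ⟶ S.obj' (i + 1) => a ≫ S.map' (i + 1) (i + 2))

/-- For a sequence `S₀ ⟶ S₁ ⟶ ⋯ ⟶ Sₙ ⟶ Sₙ₊₁` in `C`, the assertion that
`0 ⟶ C(Sₙ₊₁, -) ⟶ C(Sₙ, -) ⟶ ⋯ ⟶ C(S₁, -) ⟶ C(S₀, -)` is exact, that is, that the last `n`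
arrows form an `n`-cokernel of the first arrow `S₀ ⟶ S₁`. -/
structure IsNCokernel {n : ℕ} (S : ComposableArrows C (n + 1)) : Prop where
  injective (W : C) :
    Function.Injective (fun a : S.obj' (n + 1) ⟶ W => S.map' n (n + 1) ≫ a)
  exact (i : ℕ) (hi : i + 2 ≤ n + 1) (W : C) :
    Function.Exact (fun a : S.obj' (i + 2) ⟶ W => S.map' (i + 1) (i + 2) ≫ a)
      (fun a : S.obj' (i + 1) ⟶ W => S.map' i (i + 1) ≫ a)

end Sequences

/-- `n`-abelian categories (`n` is a positive integer): additive idempotent complete categories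
that have `n`-kernels and `n`-cokernels, in which every monomorphism followed by any of its
`n`-cokernels is an `n`-kernel sequence, and every epimorphism preceded by any of its `n`-kernels
is an `n`-cokernel sequence. "`f` is the last arrow of `S`" is phrased up to isomorphism of
arrows, along which `n`-kernels can be transported. -/
structure IsNAbelian (n : ℕ) (C : Type u) [Category.{v} C] [Preadditive C] : Prop extends
    HasFiniteBiproducts C, IsIdempotentComplete C where
  exists_nKernel {X Y : C} (f : X ⟶ Y) : ∃ S : ComposableArrows C (n + 1),
    Nonempty (Arrow.mk (S.map' n (n + 1)) ≅ Arrow.mk f) ∧ IsNKernel S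
  exists_nCokernel {X Y : C} (f : X ⟶ Y) : ∃ S : ComposableArrows C (n + 1),
    Nonempty (Arrow.mk (S.map' 0 1) ≅ Arrow.mk f) ∧ IsNCokernel S
  isNKernel_of_mono (S : ComposableArrows C (n + 1)) :
    Mono (S.map' 0 1) → IsNCokernel S → IsNKernel S
  isNCokernel_of_epi (S : ComposableArrows C (n + 1)) :
    Epi (S.map' n (n + 1)) → IsNKernel S → IsNCokernel S

/-! ### Finitely presented modules over a category -/

section Modules

variable (C : Type u) [Category.{v} C] [Preadditive C]

/-- A contravariant functor `F` from `C` to abelian groups is a finitely presented (right)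
`C`-module if it is additive and there is an exact sequence
`C(-, X) ⟶ C(-, Y) ⟶ F ⟶ 0`, exactness being componentwise. -/
def isFinitelyPresented : ObjectProperty (Cᵒᵖ ⥤ AddCommGrpCat.{v}) := fun F =>
  F.Additive ∧ ∃ (X Y : C) (f : X ⟶ Y) (p : preadditiveYoneda.obj Y ⟶ F), ∀ W : Cᵒᵖ,
    Function.Exact ((preadditiveYoneda.map f).app W) (p.app W) ∧ Function.Surjective (p.app W)

/-- `mod C`: the full subcategory of finitely presented right `C`-modules. Finitely presented left
`C`-modules are `FpMod Cᵒᵖ`. -/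
abbrev FpMod : Type (max u (v + 1)) := (isFinitelyPresented C).FullSubcategory

end Modules

/-! ### Abelian categories and coherence -/

/-- A preadditive category is abelian. -/
class IsAbelian (A : Type u) [Category.{v} A] [Preadditive A] : Prop extends
    HasFiniteProducts A, HasKernels A, HasCokernels A, IsNormalMonoCategory A,
    IsNormalEpiCategory A

/-- The abelian structure on an abelian category, with its given preadditive structure. -/
@[reducible] def IsAbelian.abelian (A : Type u) [Category.{v} A] [Preadditive A] [IsAbelian A] :
    Abelian A := { }

/-- `C` is right coherent: `mod C` is abelian. -/
class RightCoherent (C : Type u) [Category.{v} C] [Preadditive C] : Prop where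
  isAbelian : IsAbelian (FpMod C)

/-- `C` is left coherent: `mod Cᵒᵖ` is abelian. -/
abbrev LeftCoherent (C : Type u) [Category.{v} C] [Preadditive C] : Prop := RightCoherent Cᵒᵖ

instance (C : Type u) [Category.{v} C] [Preadditive C] [RightCoherent C] : Abelian (FpMod C) :=
  letI : IsAbelian (FpMod C) := RightCoherent.isAbelian
  IsAbelian.abelian (FpMod C)

/-! ### Global dimension and dominant dimension -/

section Dimensions

variable {A : Type u} [Category.{v} A] [Abelian A]

/-- The global dimension of an abelian category (a zero object has projective dimension `⊥`). -/
noncomputable def globalDimension (A : Type u) [Category.{v} A] [Abelian A] : WithBot ℕ∞ :=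
  ⨆ X : A, projectiveDimension X

/-- There is an exact sequence `0 ⟶ X ⟶ Y₁ ⟶ ⋯ ⟶ Yₘ` with `m = k + 1` and with each `Yᵢ`
projective and injective. -/
def HasProjInjCopresentation (X : A) (k : ℕ) : Prop :=
  ∃ S : ComposableArrows A (k + 1), Nonempty (S.obj' 0 ≅ X) ∧ Mono (S.map' 0 1) ∧ S.Exact ∧
    ∀ (i : ℕ) (hi : i ≤ k), Projective (S.obj' (i + 1)) ∧ Injective (S.obj' (i + 1))

/-- The dominant dimension of an object: the supremum of the positive integers `m` for which there
is an exact sequence `0 ⟶ X ⟶ Y₁ ⟶ ⋯ ⟶ Yₘ` with each `Yᵢ` projective and injective, and `0` if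
there is no such `m`. -/
noncomputable def dominantDimension (X : A) : ℕ∞ :=
  sSup {m : ℕ∞ | ∃ k : ℕ, m = ((k + 1 : ℕ) : ℕ∞) ∧ HasProjInjCopresentation X k}

/-- The dominant dimension of an abelian category: the supremum of the nonnegative integers `m`
such that every projective object has dominant dimension at least `m`. -/
noncomputable def dominantDimensionCat (A : Type u) [Category.{v} A] [Abelian A] : ℕ∞ :=
  sSup {m : ℕ∞ | ∃ k : ℕ, m = (k : ℕ∞) ∧
    ∀ P : A, Projective P → (k : ℕ∞) ≤ dominantDimension P}

end Dimensions

end HigherAbelian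

-- Let `A` be `mod C` and `y : C ⥤ A` the Yoneda embedding. Apart from the construction of `mod C`,
-- the argument uses only that `y` is additive and fully faithful, with projective values that cover
-- every object. Coherence of `C` amounts to the existence of weak kernels and weak cokernels. If
-- `f` is a weak kernel of `g`, then `cokernel (y.map f)` is the image of `y.map g`
-- (`IsWeakKernel.isShortExact`). So an `n`-kernel sequence is a projective resolution of length `n
-- + 1`, and its morphisms into `W` compute `Ext^i(-, y W)`.
--
-- Call `G` torsion if it has no nonzero morphism to any `y W`; this holds exactly when `G` is
-- presented by an epimorphism. The axiom on epimorphisms gives `Ext^i(G, y W) = 0` for torsion `G`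
-- and `i ≤ n`.
--
-- Suppose that `C` is `n`-abelian with enough injectives. The `n`-kernels bound the global
-- dimension. The crux is `IsNAbelian.injective_map`: `y` preserves injective objects. By
-- `Ext¹`-vanishing, torsion passes to subobjects, which forces a suitable morphism built from an
-- `n`-cokernel to be a monomorphism. Next, embed `X` in an injective object and take an
-- `n`-cokernel; the axiom on monomorphisms makes the image under `y` exact, and dimension shifting
-- (`IsInjectiveClass.hasCoresolution_left`) yields `n + 1` projective-injective terms. The cosyzygy
-- left over after `n + 1` steps is injective by the bound on global dimension, so projectives, and
-- then all objects, embed in injectives.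
--
-- Conversely, if the global dimension is at most `n + 1`, the last syzygy is projective, hence
-- representable because idempotents split; this gives `n`-kernels. The same bound forces a long
-- sequence of weak cokernels to split at some point, where it can be cut to an `n`-cokernel.
-- Dominant dimension at least `n + 1` makes `Ext^i(-, y W)` vanish on torsion objects for `i ≤ n`,
-- which gives both remaining axioms. The second half of the theorem is the first for `Cᵒᵖ`.

universe u' v' w

namespace HigherAbelian

open Abelian (Ext)

/-! ### Weak kernels, weak cokernels and sequences of such -/

section WeakKernels

variable {C : Type u} [Category.{v} C] [Preadditive C]

/-- `f` is a weak kernel of `g`. -/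
structure IsWeakKernel {X Y Z : C} (f : X ⟶ Y) (g : Y ⟶ Z) : Prop where
  zero : f ≫ g = 0
  exists_lift {W : C} (a : W ⟶ Y) : a ≫ g = 0 → ∃ b : W ⟶ X, b ≫ f = a

/-- `g` is a weak cokernel of `f`. -/
structure IsWeakCokernel {X Y Z : C} (f : X ⟶ Y) (g : Y ⟶ Z) : Prop where
  zero : f ≫ g = 0
  exists_desc {W : C} (a : Y ⟶ W) : f ≫ a = 0 → ∃ b : Z ⟶ W, g ≫ b = a

lemma IsWeakKernel.op {X Y Z : C} {f : X ⟶ Y} {g : Y ⟶ Z} (h : IsWeakKernel f g) :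
    IsWeakCokernel g.op f.op where
  zero := by rw [← op_comp, h.zero, op_zero]
  exists_desc a ha := by
    obtain ⟨b, hb⟩ := h.exists_lift a.unop (Quiver.Hom.op_inj (by simpa using ha))
    exact ⟨b.op, Quiver.Hom.unop_inj (by simpa using hb)⟩

lemma IsWeakCokernel.op {X Y Z : C} {f : X ⟶ Y} {g : Y ⟶ Z} (h : IsWeakCokernel f g) :
    IsWeakKernel g.op f.op where
  zero := by rw [← op_comp, h.zero, op_zero]
  exists_lift a ha := by
    obtain ⟨b, hb⟩ := h.exists_desc a.unop (Quiver.Hom.op_inj (by simpa using ha))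
    exact ⟨b.op, Quiver.Hom.unop_inj (by simpa using hb)⟩

lemma IsWeakKernel.unop {X Y Z : Cᵒᵖ} {f : X ⟶ Y} {g : Y ⟶ Z} (h : IsWeakKernel f g) :
    IsWeakCokernel g.unop f.unop where
  zero := by rw [← unop_comp, h.zero, unop_zero]
  exists_desc a ha := by
    obtain ⟨b, hb⟩ := h.exists_lift a.op (Quiver.Hom.unop_inj (by simpa using ha))
    exact ⟨b.unop, Quiver.Hom.op_inj (by simpa using hb)⟩

lemma IsWeakCokernel.unop {X Y Z : Cᵒᵖ} {f : X ⟶ Y} {g : Y ⟶ Z} (h : IsWeakCokernel f g) :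
    IsWeakKernel g.unop f.unop where
  zero := by rw [← unop_comp, h.zero, unop_zero]
  exists_lift a ha := by
    obtain ⟨b, hb⟩ := h.exists_desc a.op (Quiver.Hom.unop_inj (by simpa using ha))
    exact ⟨b.unop, Quiver.Hom.op_inj (by simpa using hb)⟩

/-- Sequences begin with a prescribed arrow only up to isomorphism of arrows; this allows an arrow
to be prepended to such a sequence. -/
lemma IsWeakCokernel.of_arrow_iso {X Y Z Y' Z' : C} {f : X ⟶ Y} {g : Y ⟶ Z} {g' : Y' ⟶ Z'}
    (h : IsWeakCokernel f g) (e : Arrow.mk g' ≅ Arrow.mk g) :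
    IsWeakCokernel (f ≫ e.inv.left) g' where
  zero := by
    have := Arrow.w e.inv
    dsimp at this
    rw [Category.assoc, this, reassoc_of% h.zero, zero_comp]
  exists_desc a ha := by
    obtain ⟨b, hb⟩ := h.exists_desc (e.inv.left ≫ a) (by simpa using ha)
    refine ⟨e.hom.right ≫ b, ?_⟩
    have := Arrow.w e.hom
    dsimp at this
    rw [← reassoc_of% this, hb, ← Category.assoc, ← Arrow.comp_left, e.hom_inv_id]
    simp

variable (C) in
/-- Every morphism has a weak kernel. -/
def HasWeakKernels : Prop :=
  ∀ ⦃X Y : C⦄ (f : X ⟶ Y), ∃ (K : C) (k : K ⟶ X), IsWeakKernel k f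

variable (C) in
/-- Every morphism has a weak cokernel. -/
def HasWeakCokernels : Prop :=
  ∀ ⦃X Y : C⦄ (f : X ⟶ Y), ∃ (Z : C) (g : Y ⟶ Z), IsWeakCokernel f g

lemma HasWeakKernels.op (h : HasWeakKernels C) : HasWeakCokernels Cᵒᵖ := fun _ _ f => by
  obtain ⟨K, k, hk⟩ := h f.unop
  exact ⟨_, k.op, hk.op⟩

lemma HasWeakCokernels.op (h : HasWeakCokernels C) : HasWeakKernels Cᵒᵖ := fun _ _ f => by
  obtain ⟨K, k, hk⟩ := h f.unop
  exact ⟨_, k.op, hk.op⟩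

lemma HasWeakKernels.unop (h : HasWeakKernels Cᵒᵖ) : HasWeakCokernels C := fun _ _ f => by
  obtain ⟨K, k, hk⟩ := h f.op
  exact ⟨_, k.unop, hk.unop⟩

lemma HasWeakCokernels.unop (h : HasWeakCokernels Cᵒᵖ) : HasWeakKernels C := fun _ _ f => by
  obtain ⟨K, k, hk⟩ := h f.op
  exact ⟨_, k.unop, hk.unop⟩

/-- `f` admits a sequence of `k` successive weak cokernels, the last of which is an epimorphism. -/
def HasCokernelSeq : ℕ → ∀ {X Y : C}, (X ⟶ Y) → Prop
  | 0, _, _, f => Epi f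
  | k + 1, _, Y, f => ∃ (Z : C) (g : Y ⟶ Z), IsWeakCokernel f g ∧ HasCokernelSeq k g

/-- `f` admits a sequence of `k` successive weak kernels, the last of which is a monomorphism. -/
def HasKernelSeq : ℕ → ∀ {X Y : C}, (X ⟶ Y) → Prop
  | 0, _, _, f => Mono f
  | k + 1, X, _, f => ∃ (K : C) (g : K ⟶ X), IsWeakKernel g f ∧ HasKernelSeq k g

lemma HasKernelSeq.op {k : ℕ} : ∀ {X Y : C} {f : X ⟶ Y}, HasKernelSeq k f →
    HasCokernelSeq k f.op := by
  induction k with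
  | zero => intro X Y f (h : Mono f); exact (inferInstance : Epi f.op)
  | succ k ih =>
    rintro X Y f ⟨K, g, hg, h⟩
    exact ⟨_, g.op, hg.op, ih h⟩

end WeakKernels

/-! ### `n`-kernel and `n`-cokernel sequences -/

section NSequences

variable {C : Type u} [Category.{v} C] [Preadditive C] {n : ℕ}

/-- Arbitrary indices and arrows of `Fin (n + 2)` replace the explicit `map'`, so that reversing a
sequence by `Fin.rev` needs no transport along equalities of objects. -/
lemma isNKernel_iff (S : ComposableArrows C (n + 1)) :
    IsNKernel S ↔ (∀ (i j : Fin (n + 2)) (a : i ⟶ j), i.val = 0 → j.val = 1 → Mono (S.map a)) ∧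
      ∀ (i j k : Fin (n + 2)) (a : i ⟶ j) (b : j ⟶ k), j.val = i.val + 1 → k.val = j.val + 1 →
        IsWeakKernel (S.map a) (S.map b) := by
  constructor
  · intro h
    constructor
    · rintro ⟨i, hi⟩ ⟨j, hj⟩ a hi' hj'
      simp only at hi' hj'
      subst hi' hj'
      exact ⟨fun x y hxy => h.injective _ hxy⟩
    · rintro ⟨i, hi⟩ ⟨j, hj⟩ ⟨k, hk⟩ a b hi' hj'
      simp only at hi' hj'
      subst hi' hj'
      exact ⟨(h.exact i (by omega) (S.obj ⟨i, hi⟩) (S.map a)).2 ⟨𝟙 _, Category.id_comp _⟩,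
        fun {W} x hx => (h.exact i (by omega) W x).1 hx⟩
  · rintro ⟨h₁, h₂⟩
    refine ⟨fun W x y hxy => ?_, fun i hi W x => ⟨fun hx => ?_, ?_⟩⟩
    · have := h₁ ⟨0, by omega⟩ ⟨1, by omega⟩ (homOfLE (by simp)) rfl rfl
      exact (cancel_mono _).1 hxy
    · exact (h₂ ⟨i, by omega⟩ ⟨i + 1, by omega⟩ ⟨i + 2, by omega⟩ (homOfLE (by simp))
        (homOfLE (by simp)) rfl rfl).exists_lift x hx
    · rintro ⟨z, rfl⟩
      have := (h₂ ⟨i, by omega⟩ ⟨i + 1, by omega⟩ ⟨i + 2, by omega⟩ (homOfLE (by simp))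
        (homOfLE (by simp)) rfl rfl).zero
      exact (Category.assoc _ _ _).trans ((congrArg (z ≫ ·) this).trans comp_zero)

lemma isNCokernel_iff (S : ComposableArrows C (n + 1)) :
    IsNCokernel S ↔
      (∀ (i j : Fin (n + 2)) (a : i ⟶ j), i.val = n → j.val = n + 1 → Epi (S.map a)) ∧
      ∀ (i j k : Fin (n + 2)) (a : i ⟶ j) (b : j ⟶ k), j.val = i.val + 1 → k.val = j.val + 1 →
        IsWeakCokernel (S.map a) (S.map b) := by
  constructor
  · intro h
    constructor
    · rintro ⟨i, hi⟩ ⟨j, hj⟩ a hi' hj'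
      simp only at hi' hj'
      subst hi' hj'
      exact ⟨fun x y hxy => h.injective _ hxy⟩
    · rintro ⟨i, hi⟩ ⟨j, hj⟩ ⟨k, hk⟩ a b hi' hj'
      simp only at hi' hj'
      subst hi' hj'
      exact ⟨(h.exact i (by omega) (S.obj ⟨i + 2, hk⟩) (S.map b)).2 ⟨𝟙 _, Category.comp_id _⟩,
        fun {W} x hx => (h.exact i (by omega) W x).1 hx⟩
  · rintro ⟨h₁, h₂⟩
    refine ⟨fun W x y hxy => ?_, fun i hi W x => ⟨fun hx => ?_, ?_⟩⟩
    · have := h₁ ⟨n, by omega⟩ ⟨n + 1, by omega⟩ (homOfLE (by simp)) rfl rfl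
      exact (cancel_epi _).1 hxy
    · exact (h₂ ⟨i, by omega⟩ ⟨i + 1, by omega⟩ ⟨i + 2, by omega⟩ (homOfLE (by simp))
        (homOfLE (by simp)) rfl rfl).exists_desc x hx
    · rintro ⟨z, rfl⟩
      have := (h₂ ⟨i, by omega⟩ ⟨i + 1, by omega⟩ ⟨i + 2, by omega⟩ (homOfLE (by simp))
        (homOfLE (by simp)) rfl rfl).zero
      exact (Category.assoc _ _ _).symm.trans ((congrArg (· ≫ z) this).trans zero_comp)

/-- The sequence of arrows in the opposite category, in the reverse order. -/
def reverse {m : ℕ} (S : ComposableArrows C m) : ComposableArrows Cᵒᵖ m where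
  obj i := op (S.obj i.rev)
  map a := (S.map (homOfLE (Fin.rev_le_rev.2 (leOfHom a)))).op
  map_id i := by rw [← op_id, ← S.map_id]; rfl
  map_comp a b := by rw [← op_comp, ← S.map_comp]; rfl

/-- The sequence of arrows in a category, in the reverse order, given by a sequence of arrows in
the opposite category. -/
def unreverse {m : ℕ} (S : ComposableArrows Cᵒᵖ m) : ComposableArrows C m where
  obj i := (S.obj i.rev).unop
  map a := (S.map (homOfLE (Fin.rev_le_rev.2 (leOfHom a)))).unop
  map_id _ := Quiver.Hom.op_inj (S.map_id _)
  map_comp _ _ := Quiver.Hom.op_inj (S.map_comp _ _)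

lemma IsNKernel.reverse {S : ComposableArrows C (n + 1)} (h : IsNKernel S) :
    IsNCokernel (reverse S) := by
  obtain ⟨h₁, h₂⟩ := (isNKernel_iff S).1 h
  refine (isNCokernel_iff _).2 ⟨fun i j a hi hj => ?_, fun i j k a b hi hj => ?_⟩
  · have := h₁ j.rev i.rev (homOfLE (Fin.rev_le_rev.2 (leOfHom a))) (by grind) (by grind)
    exact (inferInstance : Epi (S.map (homOfLE (Fin.rev_le_rev.2 (leOfHom a)))).op)
  · exact (h₂ k.rev j.rev i.rev (homOfLE (Fin.rev_le_rev.2 (leOfHom b)))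
      (homOfLE (Fin.rev_le_rev.2 (leOfHom a))) (by grind) (by grind)).op

lemma IsNCokernel.reverse {S : ComposableArrows C (n + 1)} (h : IsNCokernel S) :
    IsNKernel (reverse S) := by
  obtain ⟨h₁, h₂⟩ := (isNCokernel_iff S).1 h
  refine (isNKernel_iff _).2 ⟨fun i j a hi hj => ?_, fun i j k a b hi hj => ?_⟩
  · have := h₁ j.rev i.rev (homOfLE (Fin.rev_le_rev.2 (leOfHom a))) (by grind) (by grind)
    exact (inferInstance : Mono (S.map (homOfLE (Fin.rev_le_rev.2 (leOfHom a)))).op)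
  · exact (h₂ k.rev j.rev i.rev (homOfLE (Fin.rev_le_rev.2 (leOfHom b)))
      (homOfLE (Fin.rev_le_rev.2 (leOfHom a))) (by grind) (by grind)).op

lemma IsNKernel.unreverse {S : ComposableArrows Cᵒᵖ (n + 1)} (h : IsNKernel S) :
    IsNCokernel (unreverse S) := by
  obtain ⟨h₁, h₂⟩ := (isNKernel_iff S).1 h
  refine (isNCokernel_iff _).2 ⟨fun i j a hi hj => ?_, fun i j k a b hi hj => ?_⟩
  · have := h₁ j.rev i.rev (homOfLE (Fin.rev_le_rev.2 (leOfHom a))) (by grind) (by grind)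
    exact (inferInstance : Epi (S.map (homOfLE (Fin.rev_le_rev.2 (leOfHom a)))).unop)
  · exact (h₂ k.rev j.rev i.rev (homOfLE (Fin.rev_le_rev.2 (leOfHom b)))
      (homOfLE (Fin.rev_le_rev.2 (leOfHom a))) (by grind) (by grind)).unop

lemma IsNCokernel.unreverse {S : ComposableArrows Cᵒᵖ (n + 1)} (h : IsNCokernel S) :
    IsNKernel (unreverse S) := by
  obtain ⟨h₁, h₂⟩ := (isNCokernel_iff S).1 h
  refine (isNKernel_iff _).2 ⟨fun i j a hi hj => ?_, fun i j k a b hi hj => ?_⟩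
  · have := h₁ j.rev i.rev (homOfLE (Fin.rev_le_rev.2 (leOfHom a))) (by grind) (by grind)
    exact (inferInstance : Mono (S.map (homOfLE (Fin.rev_le_rev.2 (leOfHom a)))).unop)
  · exact (h₂ k.rev j.rev i.rev (homOfLE (Fin.rev_le_rev.2 (leOfHom b)))
      (homOfLE (Fin.rev_le_rev.2 (leOfHom a))) (by grind) (by grind)).unop

lemma isNKernel_of_reverse {S : ComposableArrows C (n + 1)} (h : IsNCokernel (reverse S)) :
    IsNKernel S := by
  obtain ⟨h₁, h₂⟩ := (isNCokernel_iff _).1 h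
  refine (isNKernel_iff _).2 ⟨fun i j a hi hj => ?_, fun i j k a b hi hj => ?_⟩
  · obtain ⟨i, rfl⟩ := Fin.rev_surjective i
    obtain ⟨j, rfl⟩ := Fin.rev_surjective j
    have : Epi (S.map a).op := h₁ j i (homOfLE (Fin.rev_le_rev.1 (leOfHom a))) (by grind) (by grind)
    exact (inferInstance : Mono (S.map a).op.unop)
  · obtain ⟨i, rfl⟩ := Fin.rev_surjective i
    obtain ⟨j, rfl⟩ := Fin.rev_surjective j
    obtain ⟨k, rfl⟩ := Fin.rev_surjective k
    exact (h₂ k j i (homOfLE (Fin.rev_le_rev.1 (leOfHom b)))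
      (homOfLE (Fin.rev_le_rev.1 (leOfHom a))) (by grind) (by grind)).unop

lemma isNCokernel_of_reverse {S : ComposableArrows C (n + 1)} (h : IsNKernel (reverse S)) :
    IsNCokernel S := by
  obtain ⟨h₁, h₂⟩ := (isNKernel_iff _).1 h
  refine (isNCokernel_iff _).2 ⟨fun i j a hi hj => ?_, fun i j k a b hi hj => ?_⟩
  · obtain ⟨i, rfl⟩ := Fin.rev_surjective i
    obtain ⟨j, rfl⟩ := Fin.rev_surjective j
    have : Mono (S.map a).op :=
      h₁ j i (homOfLE (Fin.rev_le_rev.1 (leOfHom a))) (by grind) (by grind)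
    exact (inferInstance : Epi (S.map a).op.unop)
  · obtain ⟨i, rfl⟩ := Fin.rev_surjective i
    obtain ⟨j, rfl⟩ := Fin.rev_surjective j
    obtain ⟨k, rfl⟩ := Fin.rev_surjective k
    exact (h₂ k j i (homOfLE (Fin.rev_le_rev.1 (leOfHom b)))
      (homOfLE (Fin.rev_le_rev.1 (leOfHom a))) (by grind) (by grind)).unop

lemma isNKernel_of_unreverse {S : ComposableArrows Cᵒᵖ (n + 1)} (h : IsNCokernel (unreverse S)) :
    IsNKernel S := by
  obtain ⟨h₁, h₂⟩ := (isNCokernel_iff _).1 h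
  refine (isNKernel_iff _).2 ⟨fun i j a hi hj => ?_, fun i j k a b hi hj => ?_⟩
  · obtain ⟨i, rfl⟩ := Fin.rev_surjective i
    obtain ⟨j, rfl⟩ := Fin.rev_surjective j
    have : Epi (S.map a).unop :=
      h₁ j i (homOfLE (Fin.rev_le_rev.1 (leOfHom a))) (by grind) (by grind)
    exact (inferInstance : Mono (S.map a).unop.op)
  · obtain ⟨i, rfl⟩ := Fin.rev_surjective i
    obtain ⟨j, rfl⟩ := Fin.rev_surjective j
    obtain ⟨k, rfl⟩ := Fin.rev_surjective k
    exact (h₂ k j i (homOfLE (Fin.rev_le_rev.1 (leOfHom b)))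
      (homOfLE (Fin.rev_le_rev.1 (leOfHom a))) (by grind) (by grind)).op

lemma isNCokernel_of_unreverse {S : ComposableArrows Cᵒᵖ (n + 1)} (h : IsNKernel (unreverse S)) :
    IsNCokernel S := by
  obtain ⟨h₁, h₂⟩ := (isNKernel_iff _).1 h
  refine (isNCokernel_iff _).2 ⟨fun i j a hi hj => ?_, fun i j k a b hi hj => ?_⟩
  · obtain ⟨i, rfl⟩ := Fin.rev_surjective i
    obtain ⟨j, rfl⟩ := Fin.rev_surjective j
    have : Mono (S.map a).unop :=
      h₁ j i (homOfLE (Fin.rev_le_rev.1 (leOfHom a))) (by grind) (by grind)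
    exact (inferInstance : Epi (S.map a).unop.op)
  · obtain ⟨i, rfl⟩ := Fin.rev_surjective i
    obtain ⟨j, rfl⟩ := Fin.rev_surjective j
    obtain ⟨k, rfl⟩ := Fin.rev_surjective k
    exact (h₂ k j i (homOfLE (Fin.rev_le_rev.1 (leOfHom b)))
      (homOfLE (Fin.rev_le_rev.1 (leOfHom a))) (by grind) (by grind)).op

end NSequences

/-! ### Assembling sequences from successive weak (co)kernels; duality of `n`-abelian categories -/

section NSequences

variable {C : Type u} [Category.{v} C] [Preadditive C] {n : ℕ}

lemma exists_isNCokernel {k : ℕ} : ∀ {X Y : C} {f : X ⟶ Y}, HasCokernelSeq k f →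
    ∃ S : ComposableArrows C (k + 1),
      Nonempty (Arrow.mk (S.map' 0 1) ≅ Arrow.mk f) ∧ IsNCokernel S := by
  induction k with
  | zero =>
    intro X Y f (hf : Epi f)
    refine ⟨ComposableArrows.mk₁ f, ⟨Iso.refl _⟩, (isNCokernel_iff _).2 ⟨?_, ?_⟩⟩
    · rintro ⟨i, hi⟩ ⟨j, hj⟩ a hi' hj'
      simp only at hi' hj'
      subst hi' hj'
      exact hf
    · intro i j k a b hj hk
      omega
  | succ k ih =>
    rintro X Y f ⟨Z, g, hg, h⟩
    obtain ⟨S, ⟨e⟩, hS⟩ := ih h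
    obtain ⟨h₁, h₂⟩ := (isNCokernel_iff _).1 hS
    have hw := hg.of_arrow_iso e
    refine ⟨S.precomp (f ≫ e.inv.left),
      ⟨Arrow.isoMk (Iso.refl _) (Arrow.leftFunc.mapIso e) ?_⟩, (isNCokernel_iff _).2 ⟨?_, ?_⟩⟩
    · change 𝟙 X ≫ f = (f ≫ e.inv.left) ≫ e.hom.left
      rw [Category.assoc, ← Arrow.comp_left, e.inv_hom_id]
      simp
    · rintro ⟨i, hi⟩ ⟨j, hj⟩ a hi' hj'
      simp only at hi' hj'
      subst hi' hj'
      exact h₁ ⟨k, by omega⟩ ⟨k + 1, by omega⟩ (homOfLE (by simp)) rfl rfl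
    · rintro ⟨i, hi⟩ ⟨j, hj⟩ ⟨l, hl⟩ a b hi' hj'
      simp only at hi' hj'
      subst hi' hj'
      obtain _ | i := i
      · exact hw
      · exact h₂ ⟨i, by omega⟩ ⟨i + 1, by omega⟩ ⟨i + 2, by omega⟩ (homOfLE (by simp))
          (homOfLE (by simp)) rfl rfl

lemma nonempty_arrow_iso {D : Type u'} [Category.{v'} D] {m : ℕ} (S : ComposableArrows D m)
    {i j i' j' : Fin (m + 1)} (a : i ⟶ j) (a' : i' ⟶ j') (hi : i = i') (hj : j = j') :
    Nonempty (Arrow.mk (S.map a) ≅ Arrow.mk (S.map a')) := by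
  subst hi hj
  obtain rfl : a = a' := Subsingleton.elim _ _
  exact ⟨Iso.refl _⟩

lemma nonempty_arrow_unop_iso {D : Type u'} [Category.{v'} D] {X Y : Dᵒᵖ} {f : X ⟶ Y}
    {X' Y' : D} {g : X' ⟶ Y'} :
    Nonempty (Arrow.mk f ≅ Arrow.mk g.op) → Nonempty (Arrow.mk f.unop ≅ Arrow.mk g) := by
  rintro ⟨e⟩
  refine ⟨Arrow.isoMk (Arrow.rightFunc.mapIso e).unop.symm (Arrow.leftFunc.mapIso e).unop.symm ?_⟩
  exact Quiver.Hom.op_inj (Arrow.w e.inv).symm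

lemma nonempty_arrow_op_iso {D : Type u'} [Category.{v'} D] {X Y : D} {f : X ⟶ Y}
    {X' Y' : Dᵒᵖ} {g : X' ⟶ Y'} :
    Nonempty (Arrow.mk f ≅ Arrow.mk g.unop) → Nonempty (Arrow.mk f.op ≅ Arrow.mk g) := by
  rintro ⟨e⟩
  refine ⟨Arrow.isoMk (Arrow.rightFunc.mapIso e).op.symm (Arrow.leftFunc.mapIso e).op.symm ?_⟩
  exact Quiver.Hom.unop_inj (Arrow.w e.inv).symm

lemma exists_isNKernel {k : ℕ} {X Y : C} {f : X ⟶ Y} (h : HasKernelSeq k f) :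
    ∃ S : ComposableArrows C (k + 1),
      Nonempty (Arrow.mk (S.map' k (k + 1)) ≅ Arrow.mk f) ∧ IsNKernel S := by
  obtain ⟨S, ⟨e⟩, hS⟩ := exists_isNCokernel h.op
  obtain ⟨e'⟩ := nonempty_arrow_iso S
    (homOfLE (Fin.rev_le_rev.2 (show (⟨k, by omega⟩ : Fin (k + 2)) ≤ ⟨k + 1, by omega⟩ by simp)))
    (homOfLE (show (0 : Fin (k + 2)) ≤ 1 by simp)) (by ext; simp [Fin.val_rev])
    (by ext; simp [Fin.val_rev])
  exact ⟨unreverse S, nonempty_arrow_unop_iso ⟨e' ≪≫ e⟩, hS.unreverse⟩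

lemma hasFiniteBiproducts_op [HasFiniteBiproducts C] : HasFiniteBiproducts Cᵒᵖ :=
  HasFiniteBiproducts.of_hasFiniteProducts

lemma IsNAbelian.op (h : IsNAbelian n C) : IsNAbelian n Cᵒᵖ := by
  have := h.toHasFiniteBiproducts
  have := h.toIsIdempotentComplete
  have := hasFiniteBiproducts_op (C := C)
  refine { toHasFiniteBiproducts := inferInstance, toIsIdempotentComplete := inferInstance,
           exists_nKernel := ?_, exists_nCokernel := ?_, isNKernel_of_mono := ?_,
           isNCokernel_of_epi := ?_ }
  · intro X Y f
    obtain ⟨S, ⟨e⟩, hS⟩ := h.exists_nCokernel f.unop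
    obtain ⟨e'⟩ := nonempty_arrow_iso S
      (homOfLE (Fin.rev_le_rev.2 (show (⟨n, by omega⟩ : Fin (n + 2)) ≤ ⟨n + 1, by omega⟩ by simp)))
      (homOfLE (show (0 : Fin (n + 2)) ≤ 1 by simp)) (by ext; simp [Fin.val_rev])
      (by ext; simp [Fin.val_rev])
    exact ⟨reverse S, nonempty_arrow_op_iso ⟨e' ≪≫ e⟩, hS.reverse⟩
  · intro X Y f
    obtain ⟨S, ⟨e⟩, hS⟩ := h.exists_nKernel f.unop
    obtain ⟨e'⟩ := nonempty_arrow_iso S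
      (homOfLE (Fin.rev_le_rev.2 (show (0 : Fin (n + 2)) ≤ 1 by simp)))
      (homOfLE (show (⟨n, by omega⟩ : Fin (n + 2)) ≤ ⟨n + 1, by omega⟩ by simp))
      (by ext; simp [Fin.val_rev]) (by ext; simp)
    exact ⟨reverse S, nonempty_arrow_op_iso ⟨e' ≪≫ e⟩, hS.reverse⟩
  · intro S hm hS
    refine isNKernel_of_unreverse (h.isNCokernel_of_epi _ ?_ hS.unreverse)
    obtain ⟨e'⟩ := nonempty_arrow_iso S
      (homOfLE (Fin.rev_le_rev.2 (show (⟨n, by omega⟩ : Fin (n + 2)) ≤ ⟨n + 1, by omega⟩ by simp)))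
      (homOfLE (show (0 : Fin (n + 2)) ≤ 1 by simp)) (by ext; simp [Fin.val_rev])
      (by ext; simp [Fin.val_rev])
    have := ((MorphismProperty.monomorphisms Cᵒᵖ).arrow_mk_iso_iff e').2 hm
    rw [MorphismProperty.monomorphisms.iff] at this
    exact inferInstanceAs (Epi (S.map _).unop)
  · intro S hm hS
    refine isNCokernel_of_unreverse (h.isNKernel_of_mono _ ?_ hS.unreverse)
    obtain ⟨e'⟩ := nonempty_arrow_iso S
      (homOfLE (Fin.rev_le_rev.2 (show (0 : Fin (n + 2)) ≤ 1 by simp)))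
      (homOfLE (show (⟨n, by omega⟩ : Fin (n + 2)) ≤ ⟨n + 1, by omega⟩ by simp))
      (by ext; simp [Fin.val_rev]) (by ext; simp)
    have := ((MorphismProperty.epimorphisms Cᵒᵖ).arrow_mk_iso_iff e').2 hm
    rw [MorphismProperty.epimorphisms.iff] at this
    exact inferInstanceAs (Mono (S.map _).unop)

lemma IsNAbelian.unop [HasFiniteBiproducts C] [IsIdempotentComplete C]
    (h : IsNAbelian n Cᵒᵖ) : IsNAbelian n C := by
  refine { toHasFiniteBiproducts := inferInstance, toIsIdempotentComplete := inferInstance,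
           exists_nKernel := ?_, exists_nCokernel := ?_, isNKernel_of_mono := ?_,
           isNCokernel_of_epi := ?_ }
  · intro X Y f
    obtain ⟨S, ⟨e⟩, hS⟩ := h.exists_nCokernel f.op
    obtain ⟨e'⟩ := nonempty_arrow_iso S
      (homOfLE (Fin.rev_le_rev.2 (show (⟨n, by omega⟩ : Fin (n + 2)) ≤ ⟨n + 1, by omega⟩ by simp)))
      (homOfLE (show (0 : Fin (n + 2)) ≤ 1 by simp)) (by ext; simp [Fin.val_rev])
      (by ext; simp [Fin.val_rev])
    exact ⟨unreverse S, nonempty_arrow_unop_iso ⟨e' ≪≫ e⟩, hS.unreverse⟩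
  · intro X Y f
    obtain ⟨S, ⟨e⟩, hS⟩ := h.exists_nKernel f.op
    obtain ⟨e'⟩ := nonempty_arrow_iso S
      (homOfLE (Fin.rev_le_rev.2 (show (0 : Fin (n + 2)) ≤ 1 by simp)))
      (homOfLE (show (⟨n, by omega⟩ : Fin (n + 2)) ≤ ⟨n + 1, by omega⟩ by simp))
      (by ext; simp [Fin.val_rev]) (by ext; simp)
    exact ⟨unreverse S, nonempty_arrow_unop_iso ⟨e' ≪≫ e⟩, hS.unreverse⟩
  · intro S hm hS
    refine isNKernel_of_reverse (h.isNCokernel_of_epi _ ?_ hS.reverse)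
    obtain ⟨e'⟩ := nonempty_arrow_iso S
      (homOfLE (Fin.rev_le_rev.2 (show (⟨n, by omega⟩ : Fin (n + 2)) ≤ ⟨n + 1, by omega⟩ by simp)))
      (homOfLE (show (0 : Fin (n + 2)) ≤ 1 by simp)) (by ext; simp [Fin.val_rev])
      (by ext; simp [Fin.val_rev])
    have := ((MorphismProperty.monomorphisms C).arrow_mk_iso_iff e').2 hm
    rw [MorphismProperty.monomorphisms.iff] at this
    exact inferInstanceAs (Epi (S.map _).op)
  · intro S hm hS
    refine isNCokernel_of_reverse (h.isNKernel_of_mono _ ?_ hS.reverse)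
    obtain ⟨e'⟩ := nonempty_arrow_iso S
      (homOfLE (Fin.rev_le_rev.2 (show (0 : Fin (n + 2)) ≤ 1 by simp)))
      (homOfLE (show (⟨n, by omega⟩ : Fin (n + 2)) ≤ ⟨n + 1, by omega⟩ by simp))
      (by ext; simp [Fin.val_rev]) (by ext; simp)
    have := ((MorphismProperty.epimorphisms C).arrow_mk_iso_iff e').2 hm
    rw [MorphismProperty.epimorphisms.iff] at this
    exact inferInstanceAs (Mono (S.map _).op)

end NSequences

/-! ### Short exact sequences and vanishing of `Ext` -/

section ShortExact

variable {A : Type u} [Category.{v} A] [Abelian A]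

/-- The sequence `0 ⟶ X ⟶ Y ⟶ Z ⟶ 0` is exact. -/
def IsShortExact {X Y Z : A} (f : X ⟶ Y) (g : Y ⟶ Z) : Prop :=
  ∃ w : f ≫ g = 0, (ShortComplex.mk f g w).ShortExact

namespace IsShortExact

variable {X Y Z : A} {f : X ⟶ Y} {g : Y ⟶ Z}

lemma of_refinements [Mono f] [Epi g] (w : f ≫ g = 0)
    (h : ∀ ⦃W : A⦄ (x : W ⟶ Y), x ≫ g = 0 →
      ∃ (W' : A) (π : W' ⟶ W) (_ : Epi π) (x' : W' ⟶ X), π ≫ x = x' ≫ f) :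
    IsShortExact f g :=
  ⟨w, { exact := (ShortComplex.exact_iff_exact_up_to_refinements _).2 fun _ x hx => h x hx
        mono_f := ‹_›
        epi_g := ‹_› }⟩

lemma of_mono (f : X ⟶ Y) [Mono f] : IsShortExact f (cokernel.π f) :=
  ⟨cokernel.condition f, { exact := ShortComplex.exact_cokernel f }⟩

lemma of_epi (g : Y ⟶ Z) [Epi g] : IsShortExact (kernel.ι g) g :=
  ⟨kernel.condition g, { exact := ShortComplex.exact_kernel g }⟩

variable (h : IsShortExact f g)
include h

lemma zero : f ≫ g = 0 := h.1

lemma mono : Mono f := h.2.mono_f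

lemma epi : Epi g := h.2.epi_g

lemma exists_lift {W : A} (a : W ⟶ Y) (ha : a ≫ g = 0) : ∃ b : W ⟶ X, b ≫ f = a :=
  ⟨_, KernelFork.IsLimit.lift' h.2.fIsKernel a ha |>.2⟩

lemma exists_desc {W : A} (a : Y ⟶ W) (ha : f ≫ a = 0) : ∃ b : Z ⟶ W, g ≫ b = a :=
  ⟨_, CokernelCofork.IsColimit.desc' h.2.gIsCokernel a ha |>.2⟩

lemma iso_left {X' : A} (e : X' ≅ X) : IsShortExact (e.hom ≫ f) g := by
  have := h.mono
  have := h.epi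
  refine of_refinements (by rw [Category.assoc, h.zero, comp_zero]) fun W x hx => ?_
  obtain ⟨b, rfl⟩ := h.exists_lift x hx
  exact ⟨W, 𝟙 W, inferInstance, b ≫ e.inv, by simp⟩

lemma subsingleton_ext_left [HasExt.{w} A] {N : A} {i : ℕ} (h₂ : Subsingleton (Ext Y N i))
    (h₃ : Subsingleton (Ext Z N (i + 1))) : Subsingleton (Ext X N i) := by
  refine subsingleton_of_forall_eq 0 fun x => ?_
  obtain ⟨y, rfl⟩ := Ext.contravariant_sequence_exact₁ h.2 N x (add_comm 1 i)
    (Subsingleton.elim (α := Ext Z N (i + 1)) _ _)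
  rw [Subsingleton.elim (α := Ext Y N i) y 0, Ext.comp_zero]

lemma subsingleton_ext_middle [HasExt.{w} A] {N : A} {i : ℕ} (h₁ : Subsingleton (Ext X N i))
    (h₃ : Subsingleton (Ext Z N i)) : Subsingleton (Ext Y N i) := by
  refine subsingleton_of_forall_eq 0 fun x => ?_
  obtain ⟨y, rfl⟩ := Ext.contravariant_sequence_exact₂ h.2 N x
    (Subsingleton.elim (α := Ext X N i) _ _)
  rw [Subsingleton.elim (α := Ext Z N i) y 0, Ext.comp_zero]

lemma subsingleton_ext_right [HasExt.{w} A] {N : A} {i : ℕ} (h₁ : Subsingleton (Ext X N i))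
    (h₂ : Subsingleton (Ext Y N (i + 1))) : Subsingleton (Ext Z N (i + 1)) := by
  refine subsingleton_of_forall_eq 0 fun x => ?_
  obtain ⟨y, rfl⟩ := Ext.contravariant_sequence_exact₃ h.2 N x
    (Subsingleton.elim (α := Ext Y N (i + 1)) _ _) (add_comm 1 i)
  rw [Subsingleton.elim (α := Ext X N i) y 0, Ext.comp_zero]

lemma subsingleton_ext_of_left [HasExt.{w} A] {N : A} {i : ℕ} (h₃ : Subsingleton (Ext N Z i))
    (h₂ : Subsingleton (Ext N Y (i + 1))) : Subsingleton (Ext N X (i + 1)) := by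
  refine subsingleton_of_forall_eq 0 fun x => ?_
  obtain ⟨y, rfl⟩ := Ext.covariant_sequence_exact₁ N h.2 x
    (Subsingleton.elim (α := Ext N Y (i + 1)) _ _) rfl
  rw [Subsingleton.elim (α := Ext N Z i) y 0, Ext.zero_comp]

lemma subsingleton_ext_of_right [HasExt.{w} A] {N : A} {i : ℕ} (h₂ : Subsingleton (Ext N Y i))
    (h₁ : Subsingleton (Ext N X (i + 1))) : Subsingleton (Ext N Z i) := by
  refine subsingleton_of_forall_eq 0 fun x => ?_
  obtain ⟨y, rfl⟩ := Ext.covariant_sequence_exact₃ N h.2 x rfl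
    (Subsingleton.elim (α := Ext N X (i + 1)) _ _)
  rw [Subsingleton.elim (α := Ext N Y i) y 0, Ext.zero_comp]

/-- If `Ext¹(Z, N)` vanishes, then morphisms `X ⟶ N` extend to `Y`. -/
lemma exists_extension [HasExt.{w} A] {N : A} (h₃ : Subsingleton (Ext Z N 1)) (a : X ⟶ N) :
    ∃ b : Y ⟶ N, f ≫ b = a := by
  obtain ⟨y, hy⟩ := Ext.contravariant_sequence_exact₁ h.2 N (Ext.mk₀ a) (add_comm 1 0)
    (Subsingleton.elim (α := Ext Z N 1) _ _)
  obtain ⟨b, rfl⟩ := Ext.homEquiv₀.symm.surjective y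
  exact ⟨b, Ext.homEquiv₀.symm.injective (by simpa using hy)⟩

/-- If `Y` is projective and morphisms `X ⟶ N` extend to `Y`, then `Ext¹(Z, N)` vanishes. -/
lemma subsingleton_ext_one [HasExt.{w} A] [Projective Y] {N : A}
    (hN : ∀ a : X ⟶ N, ∃ b : Y ⟶ N, f ≫ b = a) : Subsingleton (Ext Z N 1) := by
  refine subsingleton_of_forall_eq 0 fun x => ?_
  obtain ⟨y, rfl⟩ := Ext.contravariant_sequence_exact₃ h.2 N x
    (Ext.eq_zero_of_projective _) (add_comm 1 0)
  obtain ⟨a, rfl⟩ := Ext.homEquiv₀.symm.surjective y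
  obtain ⟨b, rfl⟩ := hN a
  -- The extension class composed with `f` is zero, hence so is its composite with `a = f ≫ b`.
  have := ShortComplex.ShortExact.extClass_comp_assoc (S := .mk f g h.1) h.2 (Ext.mk₀ b)
    (h := add_comm 1 0)
  simpa [Ext.mk₀_comp_mk₀] using this

end IsShortExact

lemma subsingleton_ext_zero_iff [HasExt.{w} A] {X Y : A} :
    Subsingleton (Ext X Y 0) ↔ ∀ a : X ⟶ Y, a = 0 := by
  rw [Ext.homEquiv₀.subsingleton_congr]
  exact ⟨fun _ a => Subsingleton.elim _ _, subsingleton_of_forall_eq 0⟩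

lemma subsingleton_ext_of_iso [HasExt.{w} A] {X X' Y : A} (e : X ≅ X') {i : ℕ}
    (h : Subsingleton (Ext X Y i)) : Subsingleton (Ext X' Y i) := by
  refine subsingleton_of_forall_eq 0 fun x => ?_
  have : x = (Ext.mk₀ e.inv).comp ((Ext.mk₀ e.hom).comp x (zero_add i)) (zero_add i) := by simp
  rw [this, Subsingleton.elim ((Ext.mk₀ e.hom).comp x (zero_add i)) 0, Ext.comp_zero]

end ShortExact

/-! ### Partial coresolutions by injective objects -/

section Coresolutions

open scoped ZeroObject

variable {A : Type u} [Category.{v} A] [Abelian A]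

lemma exists_refinement {X Y : A} (f : X ⟶ Y) [Epi f] {W : A} (y : W ⟶ Y) :
    ∃ (W' : A) (π : W' ⟶ W) (_ : Epi π) (x : W' ⟶ X), π ≫ y = x ≫ f :=
  surjective_up_to_refinements_of_epi f y

/-- The quotients of `N ⊆ B ⊆ J` form a short exact sequence. -/
lemma IsShortExact.exists_quotient {N B N' J R : A} {f : N ⟶ B} {g : B ⟶ N'} {i : B ⟶ J}
    {p : J ⟶ R} (h : IsShortExact f g) (h' : IsShortExact i p) :
    ∃ (Q : A) (q : J ⟶ Q) (α : N' ⟶ Q) (β : Q ⟶ R),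
      IsShortExact (f ≫ i) q ∧ IsShortExact α β := by
  have := h.mono
  have := h.epi
  have := h'.mono
  have := h'.epi
  have hq := IsShortExact.of_mono (f ≫ i)
  obtain ⟨α, hα⟩ := h.exists_desc (i ≫ cokernel.π (f ≫ i))
    (by rw [← Category.assoc, cokernel.condition])
  obtain ⟨β, hβ⟩ := hq.exists_desc p (by rw [Category.assoc, h'.zero, comp_zero])
  have : Epi β := epi_of_epi_fac hβ
  have : Mono α := Preadditive.mono_of_cancel_zero _ fun {W} x hx => by
    obtain ⟨W', π, _, a, ha⟩ := exists_refinement g x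
    obtain ⟨m, hm⟩ := hq.exists_lift (a ≫ i) (by
      rw [Category.assoc, ← hα, ← Category.assoc, ← ha, Category.assoc, hx, comp_zero])
    have : a = m ≫ f := by rw [← cancel_mono i, ← hm, Category.assoc]
    rw [← cancel_epi π, ha, this, Category.assoc, h.zero, comp_zero, comp_zero]
  refine ⟨_, _, α, β, hq, IsShortExact.of_refinements ?_ fun W x hx => ?_⟩
  · rw [← cancel_epi g, ← Category.assoc, hα, Category.assoc, hβ, h'.zero, comp_zero]
  · obtain ⟨W', π, hπ, j, hj⟩ := exists_refinement (cokernel.π (f ≫ i)) x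
    obtain ⟨b, rfl⟩ := h'.exists_lift j (by
      rw [← hβ, ← Category.assoc, ← hj, Category.assoc, hx, comp_zero])
    exact ⟨W', π, hπ, b ≫ g, by rw [hj, Category.assoc, Category.assoc, hα]⟩

/-- An embedding of the left term of a short exact sequence in an injective object gives an
embedding of the middle term. -/
lemma IsShortExact.exists_middle {X₁ X₂ X₃ J Q : A} {f : X₁ ⟶ X₂} {g : X₂ ⟶ X₃} {i : X₁ ⟶ J}
    {p : J ⟶ Q} [Injective J] (h : IsShortExact f g) (h' : IsShortExact i p) :
    ∃ (a : X₂ ⟶ J ⊞ X₃) (b : J ⊞ X₃ ⟶ Q), IsShortExact a b := by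
  have := h.mono
  have := h.epi
  have := h'.mono
  have := h'.epi
  let r : X₂ ⟶ J := Injective.factorThru i f
  have hr : f ≫ r = i := Injective.comp_factorThru i f
  -- The square formed by `r`, `g`, `p` and `θ` is bicartesian; the short exact sequence expresses
  -- this.
  obtain ⟨θ, hθ⟩ := h.exists_desc (r ≫ p) (by rw [← Category.assoc, hr, h'.zero])
  have : Epi (biprod.desc p (-θ)) := by
    have : biprod.inl ≫ biprod.desc p (-θ) = p := by simp
    exact epi_of_epi_fac this
  have : Mono (biprod.lift r g) := Preadditive.mono_of_cancel_zero _ fun {W} x hx => by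
    have h₁ : x ≫ r = 0 := by simpa using congr($hx ≫ biprod.fst)
    have h₂ : x ≫ g = 0 := by simpa using congr($hx ≫ biprod.snd)
    obtain ⟨y, rfl⟩ := h.exists_lift x h₂
    rw [Category.assoc, hr] at h₁
    rw [zero_of_comp_mono i h₁, zero_comp]
  refine ⟨biprod.lift r g, biprod.desc p (-θ),
    IsShortExact.of_refinements (by simp [hθ]) fun W x hx => ?_⟩
  obtain ⟨W', π, hπ, y, hy⟩ := exists_refinement g (x ≫ biprod.snd)
  obtain ⟨z, hz⟩ := h'.exists_lift (π ≫ x ≫ biprod.fst - y ≫ r) (by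
    rw [Preadditive.sub_comp, Category.assoc, Category.assoc, Category.assoc, ← hθ,
      ← reassoc_of% hy]
    have : x ≫ biprod.fst ≫ p - x ≫ biprod.snd ≫ θ = 0 := by
      simpa [biprod.desc_eq, sub_eq_add_neg] using hx
    rw [← Preadditive.comp_sub, this, comp_zero])
  refine ⟨W', π, hπ, y + z ≫ f, ?_⟩
  ext
  · simp [hr, hz]
  · simp [h.zero, hy]

lemma IsShortExact.biprod_left {X J Q : A} {i : X ⟶ J} {p : J ⟶ Q} (h : IsShortExact i p)
    (B : A) : IsShortExact (biprod.map (𝟙 B) i) (biprod.snd ≫ p) := by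
  have := h.mono
  have := h.epi
  refine IsShortExact.of_refinements (by simp [h.zero]) fun W x hx => ?_
  obtain ⟨y, hy⟩ := h.exists_lift (x ≫ biprod.snd) (by simpa using hx)
  refine ⟨W, 𝟙 W, inferInstance, biprod.lift (x ≫ biprod.fst) y, ?_⟩
  ext <;> simp [hy]

/-- `X` admits an exact sequence `0 ⟶ X ⟶ J₁ ⟶ ⋯ ⟶ Jₖ` with each `Jᵢ` in `I`. -/
def HasCoresolution (I : ObjectProperty A) : ℕ → A → Prop
  | 0, _ => True
  | k + 1, X => ∃ (J Q : A) (i : X ⟶ J) (p : J ⟶ Q),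
      IsShortExact i p ∧ I J ∧ HasCoresolution I k Q

/-- A class of injective objects which contains the zero objects and is closed under
biproducts. -/
structure IsInjectiveClass (I : ObjectProperty A) : Prop where
  injective {J : A} : I J → Injective J
  of_isZero {J : A} : IsZero J → I J
  biprod {J J' : A} : I J → I J' → I (J ⊞ J')

variable {I : ObjectProperty A}

lemma HasCoresolution.of_iso {k : ℕ} {X X' : A} (h : HasCoresolution I k X) (e : X' ≅ X) :
    HasCoresolution I k X' := by
  obtain _ | k := k
  · trivial
  · obtain ⟨J, Q, i, p, hip, hJ, hQ⟩ := h
    exact ⟨J, Q, _, p, hip.iso_left e, hJ, hQ⟩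

lemma HasCoresolution.of_succ {k : ℕ} {X : A} (h : HasCoresolution I (k + 1) X) :
    HasCoresolution I k X := by
  induction k generalizing X with
  | zero => trivial
  | succ k ih =>
    obtain ⟨J, Q, i, p, hip, hJ, hQ⟩ := h
    exact ⟨J, Q, i, p, hip, hJ, ih hQ⟩

lemma HasCoresolution.of_le {k l : ℕ} (hkl : k ≤ l) {X : A} (h : HasCoresolution I l X) :
    HasCoresolution I k X := by
  induction l, hkl using Nat.le_induction with
  | base => exact h
  | succ l _ ih => exact ih h.of_succ

namespace IsInjectiveClass

variable (hI : IsInjectiveClass I)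
include hI

lemma hasCoresolution_of_isZero {X : A} (hX : IsZero X) (k : ℕ) : HasCoresolution I k X := by
  induction k with
  | zero => trivial
  | succ k ih =>
    refine ⟨X, X, 𝟙 X, 0, ?_, hI.of_isZero hX, ih⟩
    have : Epi (0 : X ⟶ X) := hX.eq_of_src (𝟙 X) 0 ▸ inferInstance
    exact IsShortExact.of_refinements (by simp)
      fun W x _ => ⟨W, 𝟙 W, inferInstance, x, by simp⟩

lemma hasCoresolution_of_mem {X : A} (hX : I X) (k : ℕ) : HasCoresolution I k X := by
  obtain _ | k := k
  · trivial
  · have : Epi (0 : X ⟶ (0 : A)) := ⟨fun _ _ _ => (isZero_zero A).eq_of_src _ _⟩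
    exact ⟨X, 0, 𝟙 X, 0, IsShortExact.of_refinements (by simp)
      fun W x _ => ⟨W, 𝟙 W, inferInstance, x, by simp⟩, hX,
      hI.hasCoresolution_of_isZero (isZero_zero A) k⟩

/-- A horseshoe argument: `Y` embeds in `J₁ ⊞ Z` with quotient `Q₁`, hence in `J₁ ⊞ J₃` with a
quotient that is an extension of `Q₃` by `Q₁`. -/
lemma hasCoresolution_middle {k : ℕ} {X Y Z : A} {f : X ⟶ Y} {g : Y ⟶ Z} (h : IsShortExact f g)
    (hX : HasCoresolution I k X) (hZ : HasCoresolution I k Z) : HasCoresolution I k Y := by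
  induction k generalizing X Y Z with
  | zero => trivial
  | succ k ih =>
    obtain ⟨J₁, Q₁, i₁, p₁, h₁, hJ₁, hQ₁⟩ := hX
    obtain ⟨J₃, Q₃, i₃, p₃, h₃, hJ₃, hQ₃⟩ := hZ
    have := hI.injective hJ₁
    obtain ⟨a, b, hab⟩ := h.exists_middle h₁
    obtain ⟨Q, q, α, β, hq, hαβ⟩ := hab.exists_quotient (h₃.biprod_left J₁)
    exact ⟨_, _, _, _, hq, hI.biprod hJ₁ hJ₃, ih hαβ hQ₁ hQ₃⟩

/-- If `Y` embeds in `J` with quotient `R`, then the quotient of `J` by `X` is an extension of `R`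
by `Z`. -/
lemma hasCoresolution_left {k : ℕ} {X Y Z : A} {f : X ⟶ Y} {g : Y ⟶ Z} (h : IsShortExact f g)
    (hY : HasCoresolution I (k + 1) Y) (hZ : HasCoresolution I k Z) :
    HasCoresolution I (k + 1) X := by
  obtain ⟨J, R, i, p, hip, hJ, hR⟩ := hY
  obtain ⟨Q, q, α, β, hq, hαβ⟩ := h.exists_quotient hip
  exact ⟨_, _, _, _, hq, hJ, hI.hasCoresolution_middle hαβ hZ hR⟩

/-- Pushing out along `X ⟶ J` makes `J ⊞ Z` an extension of `Q` by `Y`, so it has a coresolution;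
then so does `Z`, the kernel of the projection onto `J`. -/
lemma hasCoresolution_right {k : ℕ} {X Y Z : A} {f : X ⟶ Y} {g : Y ⟶ Z} (h : IsShortExact f g)
    (hX : HasCoresolution I (k + 1) X) (hY : HasCoresolution I k Y) :
    HasCoresolution I k Z := by
  obtain ⟨J, Q, i, p, hip, hJ, hQ⟩ := hX
  have := hI.injective hJ
  obtain ⟨a, b, hab⟩ := h.exists_middle hip
  have h' := hI.hasCoresolution_middle hab hY hQ
  obtain _ | k := k
  · trivial
  · refine hI.hasCoresolution_left (f := biprod.inr) (g := biprod.fst) ?_ h'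
      (hI.hasCoresolution_of_mem hJ k)
    exact IsShortExact.of_refinements (by simp) fun W x hx =>
      ⟨W, 𝟙 W, inferInstance, x ≫ biprod.snd, by ext <;> simp [hx]⟩

end IsInjectiveClass

variable (A) in
lemma isInjectiveClass_isInjective : IsInjectiveClass (isInjective A) where
  injective h := h
  of_isZero h := h.injective
  biprod {J J'} h h' := by
    have : Injective J := h
    have : Injective J' := h'
    exact (inferInstance : Injective (J ⊞ J'))

variable (A) in
lemma isInjectiveClass_projInj : IsInjectiveClass (isProjective A ⊓ isInjective A) where
  injective h := h.2
  of_isZero h := ⟨h.projective, h.injective⟩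
  biprod {J J'} h h' := by
    have : Projective J := h.1
    have : Projective J' := h'.1
    have : Injective J := h.2
    have : Injective J' := h'.2
    exact ⟨(inferInstance : Projective (J ⊞ J')), (inferInstance : Injective (J ⊞ J'))⟩

end Coresolutions

/-! ### Embeddings of a category as a generating class of projective objects -/

section Generating

variable {C : Type u} [Category.{v} C] [Preadditive C] {A : Type u'} [Category.{v'} A] [Abelian A]

/-- The functor `y` is a full embedding whose values are projective objects that generate. -/
class IsProjectivelyGenerating (y : C ⥤ A) : Prop extends y.Additive, y.Full, y.Faithful where
  projective (X : C) : Projective (y.obj X)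
  exists_epi (G : A) : ∃ (X : C) (p : y.obj X ⟶ G), Epi p

instance (y : C ⥤ A) [IsProjectivelyGenerating y] (X : C) : Projective (y.obj X) :=
  IsProjectivelyGenerating.projective X

variable (y : C ⥤ A) [IsProjectivelyGenerating y]

lemma exists_refinement_map {G : A} {Y Z : C} {f : Y ⟶ Z} {x : G ⟶ y.obj Z}
    (hx : x ≫ cokernel.π (y.map f) = 0) :
    ∃ (V : C) (p : y.obj V ⟶ G) (_ : Epi p) (u : V ⟶ Y), p ≫ x = y.map (u ≫ f) := by
  obtain ⟨V, p, hp⟩ := IsProjectivelyGenerating.exists_epi (y := y) G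
  let S := ShortComplex.mk (y.map f) (cokernel.π (y.map f)) (cokernel.condition _)
  have hS : S.Exact := ShortComplex.exact_cokernel _
  obtain ⟨u, hu⟩ := y.map_surjective (hS.liftFromProjective (p ≫ x) (by simp [S, hx]))
  refine ⟨V, p, hp, u, ?_⟩
  rw [y.map_comp, hu]
  exact (hS.liftFromProjective_comp _ _).symm

lemma mono_map {X Y : C} (f : X ⟶ Y) [Mono f] : Mono (y.map f) :=
  Preadditive.mono_of_cancel_zero _ fun {G} x hx => by
    obtain ⟨V, p, _⟩ := IsProjectivelyGenerating.exists_epi (y := y) G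
    obtain ⟨a, ha⟩ := y.map_surjective (p ≫ x)
    have : a ≫ f = 0 := y.map_injective (by simp [ha, hx])
    rw [zero_of_comp_mono f this, y.map_zero] at ha
    exact zero_of_epi_comp p ha.symm

lemma isShortExact_of_mono {X Y : C} (f : X ⟶ Y) [Mono f] :
    IsShortExact (y.map f) (cokernel.π (y.map f)) := by
  have := mono_map y f
  exact IsShortExact.of_mono _

/-- The morphism from the cokernel of `f` induced by a morphism `g` such that `f ≫ g = 0`. -/
noncomputable abbrev cokernelDesc {X Y Z : C} {f : X ⟶ Y} {g : Y ⟶ Z} (w : f ≫ g = 0) :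
    cokernel (y.map f) ⟶ y.obj Z :=
  cokernel.desc (y.map f) (y.map g) (by rw [← y.map_comp, w, y.map_zero])

/-- Each weak kernel is one step of a projective resolution whose syzygies are the successive
cokernels. All dimension shifts along sequences in `C` rest on this. -/
lemma IsWeakKernel.isShortExact {X Y Z : C} {f : X ⟶ Y} {g : Y ⟶ Z} (h : IsWeakKernel f g) :
    IsShortExact (cokernelDesc y h.zero) (cokernel.π (y.map g)) := by
  have : Mono (cokernelDesc y h.zero) := Preadditive.mono_of_cancel_zero _ fun {G} x hx => by
    obtain ⟨G', π, _, z, hz⟩ := exists_refinement (cokernel.π (y.map f)) x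
    obtain ⟨V, p, _⟩ := IsProjectivelyGenerating.exists_epi (y := y) G'
    obtain ⟨a, ha⟩ := y.map_surjective (p ≫ z)
    obtain ⟨b, rfl⟩ := h.exists_lift a (y.map_injective (by
      have : z ≫ y.map g = 0 := by
        rw [← cokernel.π_desc (y.map f) (y.map g) (by rw [← y.map_comp, h.zero, y.map_zero]),
          ← Category.assoc, ← hz, Category.assoc, hx, comp_zero]
      simp [ha, this]))
    refine zero_of_epi_comp π (zero_of_epi_comp p ?_)
    rw [hz, ← Category.assoc, ← ha, y.map_comp, Category.assoc, cokernel.condition, comp_zero]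
  refine IsShortExact.of_refinements ?_ fun G x hx => ?_
  · rw [← cancel_epi (cokernel.π (y.map f)), cokernel.π_desc_assoc, cokernel.condition, comp_zero]
  · obtain ⟨V, p, hp, u, hu⟩ := exists_refinement_map y hx
    exact ⟨_, p, hp, y.map u ≫ cokernel.π _, by simp [hu]⟩

lemma exists_presentation (G : A) :
    ∃ (X Y : C) (f : X ⟶ Y), Nonempty (cokernel (y.map f) ≅ G) := by
  obtain ⟨Y, p, _⟩ := IsProjectivelyGenerating.exists_epi (y := y) G
  obtain ⟨X, q, _⟩ := IsProjectivelyGenerating.exists_epi (y := y) (kernel p)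
  obtain ⟨f, hf⟩ := y.map_surjective (q ≫ kernel.ι p)
  refine ⟨X, Y, f, ⟨?_⟩⟩
  rw [hf]
  exact cokernelEpiComp q (kernel.ι p) ≪≫
    IsColimit.coconePointUniqueUpToIso (cokernelIsCokernel _)
      (IsShortExact.of_epi p).2.gIsCokernel

include y in
-- Cover the kernel taken in `A` by some `y.obj K`; projectivity of `y.obj W` provides the lifts.
lemma hasWeakKernels : HasWeakKernels C := fun X Y f => by
  obtain ⟨K, q, _⟩ := IsProjectivelyGenerating.exists_epi (y := y) (kernel (y.map f))
  obtain ⟨k, hk⟩ := y.map_surjective (q ≫ kernel.ι _)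
  refine ⟨K, k, y.map_injective (by simp [hk]), fun {W} a ha => ?_⟩
  obtain ⟨b, hb⟩ := y.map_surjective (Projective.factorThru
    (kernel.lift (y.map f) (y.map a) (by rw [← y.map_comp, ha, y.map_zero])) q)
  exact ⟨b, y.map_injective (by simp [hb, hk])⟩

omit [Preadditive C] [IsProjectivelyGenerating y] in
lemma nonempty_cokernel_iso {X Y X' Y' : C} {f : X ⟶ Y} {f' : X' ⟶ Y'}
    (e : Arrow.mk f ≅ Arrow.mk f') : Nonempty (cokernel (y.map f) ≅ cokernel (y.map f')) :=
  ⟨cokernel.mapIso _ _ (y.mapIso (Arrow.leftFunc.mapIso e)) (y.mapIso (Arrow.rightFunc.mapIso e))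
    (by
      have := Arrow.w e.hom
      dsimp at this
      change y.map f ≫ y.map e.hom.right = y.map e.hom.left ≫ y.map f'
      rw [← y.map_comp, ← y.map_comp, this])⟩

/-- `P` is a direct summand of some `y.obj W`, and the corresponding idempotent comes from `C`,
where it splits. -/
lemma exists_iso_of_projective [IsIdempotentComplete C] (P : A) [Projective P] :
    ∃ X : C, Nonempty (P ≅ y.obj X) := by
  obtain ⟨W, p, _⟩ := IsProjectivelyGenerating.exists_epi (y := y) P
  let s : P ⟶ y.obj W := Projective.factorThru (𝟙 P) p
  have hs : s ≫ p = 𝟙 P := Projective.factorThru_comp _ _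
  obtain ⟨e, he⟩ := y.map_surjective (p ≫ s)
  obtain ⟨X, i, r, hir, hri⟩ := IsIdempotentComplete.idempotents_split W e
    (y.map_injective (by simp [he, reassoc_of% hs]))
  refine ⟨X, ⟨⟨s ≫ y.map r, y.map i ≫ p, ?_, ?_⟩⟩⟩
  · rw [Category.assoc, ← y.map_comp_assoc, hri, he, Category.assoc, hs, Category.comp_id, hs]
  · rw [Category.assoc, ← Category.assoc p, ← he, ← y.map_comp, ← y.map_comp, ← hri,
      Category.assoc, hir, Category.comp_id, hir, y.map_id]

lemma injective_of_map {J : C} [Injective (y.obj J)] : Injective J where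
  factors {X Y} g f _ := by
    have := mono_map y f
    obtain ⟨b, hb⟩ := y.map_surjective (Injective.factorThru (y.map g) (y.map f))
    exact ⟨b, y.map_injective (by simp [hb])⟩

/-- Morphisms from the cokernel of `y.map f` are morphisms annihilated by `f`. -/
lemma exists_map_eq {X Y W : C} {f : X ⟶ Y} (a : cokernel (y.map f) ⟶ y.obj W) :
    ∃ b : Y ⟶ W, f ≫ b = 0 ∧ y.map b = cokernel.π (y.map f) ≫ a := by
  obtain ⟨b, hb⟩ := y.map_surjective (cokernel.π (y.map f) ≫ a)
  exact ⟨b, y.map_injective (by simp [hb]), hb⟩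

/-- Required for all `W`, the right-hand side says that `g` is a weak cokernel of `f`. Thus the
passage between weak kernels and weak cokernels is a vanishing of `Ext¹`. -/
lemma IsWeakKernel.subsingleton_ext_one_iff [HasExt.{w} A] {X Y Z : C} {f : X ⟶ Y} {g : Y ⟶ Z}
    (h : IsWeakKernel f g) (W : C) :
    Subsingleton (Ext (cokernel (y.map g)) (y.obj W) 1) ↔
      ∀ a : Y ⟶ W, f ≫ a = 0 → ∃ b : Z ⟶ W, g ≫ b = a := by
  refine ⟨fun h' a ha => ?_, fun h' => (h.isShortExact y).subsingleton_ext_one fun a => ?_⟩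
  · obtain ⟨b, hb⟩ := (h.isShortExact y).exists_extension h'
      (cokernel.desc _ (y.map a) (by rw [← y.map_comp, ha, y.map_zero]))
    obtain ⟨b, rfl⟩ := y.map_surjective b
    refine ⟨b, y.map_injective ?_⟩
    simpa using congr(cokernel.π (y.map f) ≫ $hb)
  · obtain ⟨a', ha, ha'⟩ := exists_map_eq y a
    obtain ⟨b, rfl⟩ := h' a' ha
    refine ⟨y.map b, ?_⟩
    rw [← cancel_epi (cokernel.π (y.map f)), ← ha', y.map_comp, cokernel.π_desc_assoc]

/-- The objects without nonzero morphisms to objects in the image of `y`. -/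
def IsTorsion (G : A) : Prop := ∀ ⦃W : C⦄ (a : G ⟶ y.obj W), a = 0

variable {y}

lemma isTorsion_cokernel_iff {X Y : C} (f : X ⟶ Y) :
    IsTorsion y (cokernel (y.map f)) ↔ Epi f := by
  refine ⟨fun h => Preadditive.epi_of_cancel_zero _ fun {W} a ha => y.map_injective ?_,
    fun h W a => ?_⟩
  · have := h (cokernel.desc (y.map f) (y.map a) (by rw [← y.map_comp, ha, y.map_zero]))
    rw [← cokernel.π_desc (y.map f) (y.map a) (by rw [← y.map_comp, ha, y.map_zero]), this,
      comp_zero, y.map_zero]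
  · obtain ⟨b, hb, hb'⟩ := exists_map_eq y a
    rw [zero_of_epi_comp f hb, y.map_zero] at hb'
    exact zero_of_epi_comp _ hb'.symm

omit [Preadditive C] [IsProjectivelyGenerating y] in
lemma IsTorsion.of_epi {G H : A} (h : IsTorsion y G) (p : G ⟶ H) [Epi p] : IsTorsion y H :=
  fun _ _ => zero_of_epi_comp p (h _)

end Generating

/-! ### Consecutive arrows of `n`-kernel and `n`-cokernel sequences -/

section NSequences

variable {C : Type u} [Category.{v} C] [Preadditive C] {n : ℕ} {S : ComposableArrows C (n + 1)}

lemma IsNKernel.mono_map (h : IsNKernel S) : Mono (S.map' 0 1) :=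
  ((isNKernel_iff S).1 h).1 _ _ _ rfl rfl

lemma IsNKernel.isWeakKernel (h : IsNKernel S) (i : ℕ) (hi : i + 2 ≤ n + 1) :
    IsWeakKernel (S.map' i (i + 1)) (S.map' (i + 1) (i + 2)) :=
  ((isNKernel_iff S).1 h).2 _ _ _ _ _ rfl rfl

lemma IsNCokernel.epi_map (h : IsNCokernel S) : Epi (S.map' n (n + 1)) :=
  ((isNCokernel_iff S).1 h).1 _ _ _ rfl rfl

lemma IsNCokernel.isWeakCokernel (h : IsNCokernel S) (i : ℕ) (hi : i + 2 ≤ n + 1) :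
    IsWeakCokernel (S.map' i (i + 1)) (S.map' (i + 1) (i + 2)) :=
  ((isNCokernel_iff S).1 h).2 _ _ _ _ _ rfl rfl

lemma isNKernel_mk (h : Mono (S.map' 0 1)) (h' : ∀ (i : ℕ) (hi : i + 2 ≤ n + 1),
    IsWeakKernel (S.map' i (i + 1)) (S.map' (i + 1) (i + 2))) : IsNKernel S := by
  refine (isNKernel_iff S).2 ⟨?_, ?_⟩
  · rintro ⟨i, hi⟩ ⟨j, hj⟩ a hi' hj'
    simp only at hi' hj'
    subst hi' hj'
    exact h
  · rintro ⟨i, hi⟩ ⟨j, hj⟩ ⟨k, hk⟩ a b hi' hj'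
    simp only at hi' hj'
    subst hi' hj'
    exact h' i (by omega)

lemma isNCokernel_mk (h : Epi (S.map' n (n + 1))) (h' : ∀ (i : ℕ) (hi : i + 2 ≤ n + 1),
    IsWeakCokernel (S.map' i (i + 1)) (S.map' (i + 1) (i + 2))) : IsNCokernel S := by
  refine (isNCokernel_iff S).2 ⟨?_, ?_⟩
  · rintro ⟨i, hi⟩ ⟨j, hj⟩ a hi' hj'
    simp only at hi' hj'
    subst hi' hj'
    exact h
  · rintro ⟨i, hi⟩ ⟨j, hj⟩ ⟨k, hk⟩ a b hi' hj'
    simp only at hi' hj'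
    subst hi' hj'
    exact h' i (by omega)

end NSequences

/-! ### Modules over an `n`-abelian category with enough injectives -/

section NAbelian

variable {C : Type u} [Category.{v} C] [Preadditive C] {A : Type u'} [Category.{v'} A] [Abelian A]
  {y : C ⥤ A} [IsProjectivelyGenerating y] {n : ℕ}

/-- The weak cokernel property is the vanishing of `Ext¹` of every cokernel with `j ≥ 1`; the higher
groups reduce to it by shifting along the syzygies. -/
lemma subsingleton_ext_of_isNKernel_of_isNCokernel [HasExt.{w} A] {S : ComposableArrows C (n + 1)}
    (h : IsNKernel S) (h' : IsNCokernel S) (W : C) (j : ℕ) (hj : j ≤ n) (i : ℕ) (hi : 1 ≤ i)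
    (hij : i ≤ j) :
    Subsingleton (Ext (cokernel (y.map (S.map' j (j + 1)))) (y.obj W) i) := by
  induction j generalizing i with
  | zero => omega
  | succ j ih =>
    obtain _ | _ | i := i
    · omega
    · exact ((h.isWeakKernel j (by omega)).subsingleton_ext_one_iff y W).2
        fun a ha => (h'.isWeakCokernel j (by omega)).exists_desc a ha
    · exact ((h.isWeakKernel j (by omega)).isShortExact y).subsingleton_ext_right
        (ih (by omega) (i + 1) (by omega) (by omega)) (Ext.subsingleton_of_projective _ _ _)

/-- A torsion object is presented by an epimorphism, whose `n`-kernel is an `n`-cokernel sequence by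
the axiom. -/
lemma IsNAbelian.subsingleton_ext_of_isTorsion [HasExt.{w} A] (hC : IsNAbelian n C) {G : A}
    (hG : IsTorsion y G) (W : C) (i : ℕ) (hi : i ≤ n) : Subsingleton (Ext G (y.obj W) i) := by
  obtain ⟨X, Y, f, ⟨e⟩⟩ := exists_presentation y G
  obtain ⟨S, ⟨e'⟩, hS⟩ := hC.exists_nKernel f
  obtain ⟨e''⟩ := nonempty_cokernel_iso y e'
  have hT : IsTorsion y (cokernel (y.map (S.map' n (n + 1)))) := hG.of_epi (e'' ≪≫ e).inv
  obtain _ | i := i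
  · exact subsingleton_ext_zero_iff.2 fun a => hG a
  · exact subsingleton_ext_of_iso (e'' ≪≫ e)
      (subsingleton_ext_of_isNKernel_of_isNCokernel hS
        (hC.isNCokernel_of_epi S ((isTorsion_cokernel_iff _).1 hT) hS) W n le_rfl _ (by omega) hi)

omit [Preadditive C] [IsProjectivelyGenerating y] in
-- The quotient of `G` by `H` is again torsion, so it has no `Ext¹` into `y.obj W` and morphisms
-- from `H` extend to `G`, where they vanish.
lemma IsTorsion.of_mono [HasExt.{w} A] {G H : A} (hG : IsTorsion y G)
    (hext : ∀ ⦃G : A⦄, IsTorsion y G → ∀ W, Subsingleton (Ext G (y.obj W) 1)) (m : H ⟶ G) [Mono m] :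
    IsTorsion y H := fun W a => by
  obtain ⟨b, rfl⟩ := (IsShortExact.of_mono m).exists_extension
    (hext (hG.of_epi (cokernel.π m)) W) a
  rw [hG b, comp_zero]

variable (y) in
-- Since `f` need not be a weak kernel of `g`, the morphism `cokernelDesc y w` may fail to be a
-- monomorphism; `M` is its image.
lemma exists_image {X Y Z : C} {f : X ⟶ Y} {g : Y ⟶ Z} (w : f ≫ g = 0) :
    ∃ (M : A) (e : cokernel (y.map f) ⟶ M) (m : M ⟶ y.obj Z), Epi e ∧
      e ≫ m = cokernelDesc y w ∧ IsShortExact m (cokernel.π (y.map g)) := by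
  refine ⟨Abelian.image (cokernelDesc y w), Abelian.factorThruImage _, Abelian.image.ι _,
    inferInstance, Abelian.image.fac _, IsShortExact.of_refinements ?_ fun G x hx => ?_⟩
  · rw [← cancel_epi (Abelian.factorThruImage (cokernelDesc y w)),
      ← cancel_epi (cokernel.π (y.map f)), ← Category.assoc (Abelian.factorThruImage _),
      Abelian.image.fac, cokernel.π_desc_assoc, cokernel.condition, comp_zero, comp_zero]
  · obtain ⟨V, p, hp, a, ha⟩ := exists_refinement_map y hx
    refine ⟨_, p, hp, y.map a ≫ cokernel.π (y.map f) ≫ Abelian.factorThruImage _, ?_⟩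
    rw [Category.assoc, Category.assoc, Abelian.image.fac, cokernel.π_desc, ha, y.map_comp]

/-- `Ext¹(M, y W)` embeds in `Ext²(cokernel (y.map g), y W) = 0`, so a morphism from the kernel to
`y W` extends to the cokernel of `y.map f`. There it factors through `g`, hence it vanishes on the
kernel. -/
lemma IsWeakCokernel.isTorsion_kernel [HasExt.{w} A] {X Y Z : C} {f : X ⟶ Y} {g : Y ⟶ Z}
    (h : IsWeakCokernel f g) {M : A} {e : cokernel (y.map f) ⟶ M} {m : M ⟶ y.obj Z} [Epi e]
    (hem : e ≫ m = cokernelDesc y h.zero) (hm : IsShortExact m (cokernel.π (y.map g)))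
    (hext : ∀ W, Subsingleton (Ext (cokernel (y.map g)) (y.obj W) 2)) :
    IsTorsion y (kernel e) := fun W a => by
  obtain ⟨b, rfl⟩ := (IsShortExact.of_epi e).exists_extension (N := y.obj W)
    (hm.subsingleton_ext_left (Ext.subsingleton_of_projective _ _ _) (hext W)) a
  obtain ⟨c, hc, hc'⟩ := exists_map_eq y b
  obtain ⟨d, rfl⟩ := h.exists_desc c hc
  have : b = e ≫ m ≫ y.map d := by
    rw [← cancel_epi (cokernel.π (y.map f)), ← hc', reassoc_of% hem, cokernel.π_desc_assoc,
      y.map_comp]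
  rw [this, kernel.condition_assoc, zero_comp]

/-- Descending induction on `j`, from the torsion cokernel at `j = n`. For smaller `j`, the `j`-th
cokernel is an extension of the image `M` by a torsion object, and `Ext^i(M, y W)` embeds in `Ext^(i
+ 1)` of the next cokernel. -/
lemma IsNCokernel.subsingleton_ext [HasExt.{w} A] (hT : ∀ ⦃G : A⦄, IsTorsion y G →
      ∀ W, ∀ i ≤ n, Subsingleton (Ext G (y.obj W) i)) {S : ComposableArrows C (n + 1)}
    (h : IsNCokernel S) (d j : ℕ) (hj : j + d = n) (i : ℕ) (hi : 1 ≤ i) (hij : i ≤ j) (W : C) :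
    Subsingleton (Ext (cokernel (y.map (S.map' j (j + 1)))) (y.obj W) i) := by
  induction d generalizing i j W with
  | zero =>
    obtain rfl : j = n := hj
    exact hT ((isTorsion_cokernel_iff _).2 h.epi_map) W i hij
  | succ d ih =>
    have hw := h.isWeakCokernel j (by omega)
    obtain ⟨M, e, m, he, hem, hm⟩ := exists_image y hw.zero
    have hk := hw.isTorsion_kernel hem hm (ih (j + 1) (by omega) 2 (by omega) (by omega))
    exact (IsShortExact.of_epi e).subsingleton_ext_middle (hT hk W i (by omega))
      (hm.subsingleton_ext_left (by
        obtain ⟨i, rfl⟩ := Nat.exists_eq_add_of_le' hi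
        exact Ext.subsingleton_of_projective _ _ _)
        (ih (j + 1) (by omega) _ (by omega) (by omega) W))

/-- Let `k ≫ c = 0` be such that `k` is a weak kernel of `c ≫ φ`. If a morphism `μ` is such that
`φ` vanishes on the kernel of `μ`, and if the kernel of `μ` modulo the image of `c` is torsion,
then `μ` is a monomorphism. -/
lemma mono_of_isTorsion [HasExt.{w} A]
    (hext : ∀ ⦃G : A⦄, IsTorsion y G → ∀ W, Subsingleton (Ext G (y.obj W) 1))
    {K X W Y B : C} {k : K ⟶ X} {c : X ⟶ W} (hkc : k ≫ c = 0) {φ : W ⟶ Y}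
    (hk : IsWeakKernel k (c ≫ φ)) {μ : W ⟶ B}
    (hμ : ∀ ⦃V : C⦄ (x : V ⟶ W), x ≫ μ = 0 → x ≫ φ = 0) {H : A} (hH : IsTorsion y H)
    (h : H ⟶ cokernel (y.map c)) (hh : ∀ ⦃G : A⦄ (x : G ⟶ y.obj W), x ≫ y.map μ = 0 →
      ∃ x' : G ⟶ H, x' ≫ h = x ≫ cokernel.π (y.map c)) : Mono μ := by
  obtain ⟨l, hl⟩ := hh (kernel.ι (y.map μ)) (kernel.condition _)
  -- An element of the kernel of `y.map μ` that dies in the cokernel of `y.map c` is locally `u ≫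
  -- c`. As `φ` kills it, `u` factors through `k`, so `u ≫ c = 0`.
  have : Mono l := Preadditive.mono_of_cancel_zero _ fun {G} z hz => by
    have hz' : (z ≫ kernel.ι (y.map μ)) ≫ cokernel.π (y.map c) = 0 := by
      rw [Category.assoc, ← hl, reassoc_of% hz, zero_comp]
    obtain ⟨V, p, _, u, hu⟩ := exists_refinement_map y hz'
    have h₁ : (u ≫ c) ≫ μ = 0 := y.map_injective (by
      rw [y.map_comp, ← hu, Category.assoc, Category.assoc, kernel.condition, comp_zero, comp_zero,
        y.map_zero])
    obtain ⟨t, rfl⟩ := hk.exists_lift u (by rw [← Category.assoc, hμ _ h₁])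
    rw [Category.assoc, hkc, comp_zero, y.map_zero] at hu
    exact zero_of_comp_mono _ (zero_of_epi_comp p hu)
  -- The kernel of `y.map μ` is a subobject of `H`, hence torsion; its inclusion into `y.obj W` is
  -- therefore zero.
  have hι := hH.of_mono hext l (kernel.ι (y.map μ))
  have := Preadditive.mono_of_kernel_zero hι
  exact y.mono_of_mono_map this

lemma IsWeakKernel.of_arrow_iso {K X Y K' X' : C} {k : K ⟶ X} {f : X ⟶ Y} {k' : K' ⟶ X'}
    (h : IsWeakKernel k f) (e : Arrow.mk k' ≅ Arrow.mk k) :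
    IsWeakKernel k' (e.hom.right ≫ f) where
  zero := by
    have := Arrow.w e.hom
    dsimp at this
    rw [← reassoc_of% this, h.zero, comp_zero]
  exists_lift a ha := by
    obtain ⟨b, hb⟩ := h.exists_lift (a ≫ e.hom.right) (by simpa using ha)
    refine ⟨b ≫ e.inv.left, ?_⟩
    have := Arrow.w e.inv
    dsimp at this
    rw [Category.assoc, this, ← Category.assoc, hb, Category.assoc, ← Arrow.comp_right,
      e.hom_inv_id]
    simp

variable (y) in
-- Let `k` be a weak kernel of `f` and let `c` be the first arrow of an `n`-cokernel of `k`. Then `f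
-- = c ≫ φ`, and a morphism to `J` killed by `k` has the form `c ≫ b`. If `n = 1`, then `φ` is a
-- monomorphism and `b` extends along it. If `n ≥ 2`, only the pair of `φ` and the next arrow `ψ` of
-- the `n`-cokernel is a monomorphism. This suffices: `b = ψ ≫ t₁ + φ ≫ t₂` implies `c ≫ b = f ≫
-- t₂`, because `c ≫ ψ = 0`.
lemma IsNAbelian.injective_map (hn : 1 ≤ n) (hC : IsNAbelian n C) (J : C) [Injective J] :
    Injective (y.obj J) := by
  let := HasExt.standard A
  have := hC.toHasFiniteBiproducts
  have := hasBinaryBiproducts_of_finite_biproducts C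
  have hext : ∀ ⦃G : A⦄, IsTorsion y G → ∀ W, ∀ i ≤ n, Subsingleton (Ext G (y.obj W) i) :=
    fun G hG => hC.subsingleton_ext_of_isTorsion hG
  have hext₁ : ∀ ⦃G : A⦄, IsTorsion y G → ∀ W, Subsingleton (Ext G (y.obj W) 1) :=
    fun G hG W => hext hG W 1 hn
  refine injective_iff_subsingleton_ext_one.2 fun G => ?_
  obtain ⟨X', Y, f', ⟨e₁⟩⟩ := exists_presentation y G
  obtain ⟨K, k, hk⟩ := hasWeakKernels y f'
  obtain ⟨S, ⟨e⟩, hS⟩ := hC.exists_nCokernel k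
  have hf := hk.of_arrow_iso e
  obtain ⟨e₂⟩ := nonempty_cokernel_iso y (f := e.hom.right ≫ f') (f' := f')
    (Arrow.isoMk (Arrow.rightFunc.mapIso e) (Iso.refl _) (Category.comp_id _).symm)
  refine subsingleton_ext_of_iso (e₂ ≪≫ e₁) ((hf.subsingleton_ext_one_iff y J).2 fun a ha => ?_)
  have h₀ := hS.isWeakCokernel 0 (by omega)
  obtain ⟨b, rfl⟩ := h₀.exists_desc a ha
  obtain ⟨φ, hφ⟩ := h₀.exists_desc _ hf.zero
  rw [← hφ] at hf ⊢
  obtain rfl | hn' := hn.eq_or_lt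
  · have := mono_of_isTorsion hext₁ h₀.zero hf (fun _ _ h => h)
      ((isTorsion_cokernel_iff _).2 hS.epi_map) (𝟙 _) (fun G x _ => ⟨_, Category.comp_id _⟩)
    exact ⟨Injective.factorThru b φ, by rw [Category.assoc, Injective.comp_factorThru]⟩
  · have h₁ := hS.isWeakCokernel 1 (by omega)
    obtain ⟨M, e, m, he, hem, hm⟩ := exists_image y h₁.zero
    have hT := h₁.isTorsion_kernel hem hm
      (hS.subsingleton_ext hext (n - 2) 2 (by omega) 2 (by omega) le_rfl)
    have := hm.mono
    let ψ : S.obj' 2 ⟶ S.obj' 3 := S.map' 2 3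
    -- The kernel of `y.map ψ` modulo the image of `c` is the kernel of `e`, which is torsion by
    -- `hT`.
    have hμ : Mono (biprod.lift ψ φ) := by
      refine mono_of_isTorsion hext₁ h₀.zero hf (fun V x hx => ?_) hT (kernel.ι e)
        fun G x hx => ?_
      · simpa using congr($hx ≫ biprod.snd)
      · have : x ≫ y.map ψ = 0 := by
          rw [← biprod.lift_fst ψ φ, y.map_comp, reassoc_of% hx, zero_comp]
        refine ⟨kernel.lift e (x ≫ cokernel.π _) ?_, kernel.lift_ι _ _ _⟩
        rw [← cancel_mono m, Category.assoc, Category.assoc, hem, cokernel.π_desc, zero_comp, this]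
    obtain ⟨t, rfl⟩ : ∃ t, biprod.lift ψ φ ≫ t = b := ⟨_, Injective.comp_factorThru b _⟩
    refine ⟨biprod.inr ≫ t, ?_⟩
    rw [biprod.lift_eq, Preadditive.add_comp, Preadditive.comp_add, Category.assoc, Category.assoc,
      Category.assoc, reassoc_of% h₁.zero, zero_comp]
    exact (zero_add _).symm

end NAbelian

/-! ### Global dimension, dominant dimension and enough injectives in the `n`-abelian case -/

section NAbelian

variable {C : Type u} [Category.{v} C] [Preadditive C] {A : Type u'} [Category.{v'} A] [Abelian A]
  (y : C ⥤ A) [IsProjectivelyGenerating y] {n : ℕ}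

lemma IsNKernel.isShortExact {S : ComposableArrows C (n + 1)} (h : IsNKernel S) :
    IsShortExact (y.map (S.map' 0 1)) (cokernel.π (y.map (S.map' 0 1))) := by
  have : Mono (S.map (homOfLE _ : (⟨0, _⟩ : Fin (n + 2)) ⟶ ⟨1, _⟩)) := h.mono_map
  exact isShortExact_of_mono y _

/-- The `n`-cokernel of an embedding into an injective object gives an exact sequence under `y`, but
only its first term `y.obj (S.obj' 1)` is known to be injective. The later terms have shorter
coresolutions by induction on the length, which is enough for dimension shifting. -/
lemma IsNAbelian.hasCoresolution (hn : 1 ≤ n) (hC : IsNAbelian n C) [EnoughInjectives C] (k : ℕ)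
    (hk : k ≤ n + 1) (X : C) : HasCoresolution (isProjective A ⊓ isInjective A) k (y.obj X) := by
  have hI := isInjectiveClass_projInj A
  induction k generalizing X with
  | zero => trivial
  | succ k ih =>
    replace ih := ih (by omega)
    obtain ⟨S, ⟨e⟩, hS⟩ := hC.exists_nCokernel (Injective.ι X)
    have : Mono (S.map' 0 1) :=
      ((MorphismProperty.monomorphisms C).arrow_mk_iso_iff e).2
        (inferInstance : Mono (Injective.ι X))
    have hS' := hC.isNKernel_of_mono S this hS
    have key : ∀ (d j : ℕ) (hj : j + d ≤ n), d ≤ k →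
        HasCoresolution (isProjective A ⊓ isInjective A) d
          (cokernel (y.map (S.map' j (j + 1)))) := by
      intro d
      induction d with
      | zero => intros; trivial
      | succ d ihd =>
        intro j hj hd
        exact hI.hasCoresolution_left ((hS'.isWeakKernel j (by omega)).isShortExact y)
          ((ih _).of_le hd) (ihd (j + 1) (by omega) (by omega))
    have : Injective (S.obj' 1) :=
      Injective.of_iso (Arrow.rightFunc.mapIso e).symm
        (inferInstance : Injective (Injective.under X))
    have : Injective (y.obj (S.obj' 1)) := hC.injective_map y hn _
    refine HasCoresolution.of_iso ?_ (y.mapIso (Arrow.leftFunc.mapIso e).symm)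
    exact ⟨_, _, _, _, hS'.isShortExact y, ⟨inferInstance, this⟩,
      key k 0 (by omega) le_rfl⟩

include y in
lemma IsNAbelian.hasProjectiveDimensionLT (hC : IsNAbelian n C) (G : A) :
    HasProjectiveDimensionLT G (n + 2) := by
  obtain ⟨X, Y, f, ⟨e⟩⟩ := exists_presentation y G
  obtain ⟨S, ⟨e'⟩, hS⟩ := hC.exists_nKernel f
  obtain ⟨e''⟩ := nonempty_cokernel_iso y e'
  have key : ∀ (j : ℕ) (hj : j ≤ n),
      HasProjectiveDimensionLT (cokernel (y.map (S.map' j (j + 1)))) (j + 2) := by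
    intro j
    induction j with
    | zero =>
      intro hj
      exact (hS.isShortExact y).2.hasProjectiveDimensionLT_X₃ 1
        (inferInstanceAs (HasProjectiveDimensionLT (y.obj _) 1))
        (inferInstanceAs (HasProjectiveDimensionLT (y.obj _) 2))
    | succ j ih =>
      intro hj
      exact ((hS.isWeakKernel j (by omega)).isShortExact y).2.hasProjectiveDimensionLT_X₃ (j + 2)
        (ih (by omega)) (hasProjectiveDimensionLT_of_ge (y.obj _) 1 _ (by omega))
  have := key n le_rfl
  exact hasProjectiveDimensionLT_of_iso (e'' ≪≫ e) _

/-- If `N` has an `m`-step coresolution by projective-injective objects and `Ext^{m+i}(-, N)`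
vanishes for positive `i`, then `N` has injective coresolutions of any length. -/
lemma hasCoresolution_isInjective_of_subsingleton_ext [HasExt.{w} A] {m : ℕ} {N : A}
    (h : HasCoresolution (isProjective A ⊓ isInjective A) m N)
    (h' : ∀ (G : A) (i : ℕ), 1 ≤ i → Subsingleton (Ext G N (m + i))) (k : ℕ) :
    HasCoresolution (isInjective A) k N := by
  induction m generalizing N k with
  | zero =>
    -- After all `m` steps the hypothesis is the vanishing of `Ext¹(-, N)`, that is, injectivity of
    -- `N`.
    exact (isInjectiveClass_isInjective A).hasCoresolution_of_mem
      (injective_iff_subsingleton_ext_one.2 fun G => by simpa using h' G 1 le_rfl) k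
  | succ m ih =>
    obtain ⟨J, Q, i, p, hip, hJ, hQ⟩ := h
    have : Injective J := hJ.2
    obtain _ | k := k
    · trivial
    · refine ⟨J, Q, i, p, hip, hJ.2, ih hQ (fun G l hl => ?_) k⟩
      refine hip.subsingleton_ext_of_right ?_ ?_
      · obtain ⟨l, rfl⟩ := Nat.exists_eq_add_of_le' hl
        exact Ext.subsingleton_of_injective _ _ _
      · have := h' G l hl
        rwa [add_right_comm] at this

include y in
-- Induction on the projective dimension, starting from representables. All lengths `k` are treated
-- together, since a coresolution of a quotient uses one of the kernel that is longer by one.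
lemma hasCoresolution_isInjective [IsIdempotentComplete C]
    (h : ∀ X : C, HasCoresolution (isProjective A ⊓ isInjective A) (n + 1) (y.obj X))
    (h' : ∀ G : A, HasProjectiveDimensionLT G (n + 2)) (d : ℕ) (G : A)
    (hG : HasProjectiveDimensionLT G (d + 1)) (k : ℕ) : HasCoresolution (isInjective A) k G := by
  let := HasExt.standard A
  have hy (X : C) (k : ℕ) : HasCoresolution (isInjective A) k (y.obj X) :=
    hasCoresolution_isInjective_of_subsingleton_ext (h X)
      (fun G i hi => HasProjectiveDimensionLT.subsingleton G (n + 2) _ (by omega) _) k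
  induction d generalizing G k with
  | zero =>
    have : Projective G := projective_iff_hasProjectiveDimensionLT_one.2 hG
    obtain ⟨X, ⟨e⟩⟩ := exists_iso_of_projective y G
    exact (hy X k).of_iso e
  | succ d ih =>
    obtain ⟨X, p, _⟩ := IsProjectivelyGenerating.exists_epi (y := y) G
    have hp := IsShortExact.of_epi p
    exact (isInjectiveClass_isInjective A).hasCoresolution_right hp
      (ih _ (hp.2.hasProjectiveDimensionLT_X₁ (d + 1)
        (hasProjectiveDimensionLT_of_ge (y.obj X) 1 _ (by omega)) hG) _) (hy X k)

include y in
lemma IsNAbelian.enoughInjectives_of_isProjectivelyGenerating (hn : 1 ≤ n) (hC : IsNAbelian n C)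
    [EnoughInjectives C] : EnoughInjectives A where
  presentation G := by
    have := hC.toIsIdempotentComplete
    obtain ⟨J, Q, i, p, hip, hJ, -⟩ := hasCoresolution_isInjective y
      (hC.hasCoresolution y hn (n + 1) le_rfl) (hC.hasProjectiveDimensionLT y) (n + 1) G
      (hC.hasProjectiveDimensionLT y G) 1
    exact ⟨{ J := J, injective := hJ, f := i, mono := hip.mono }⟩

end NAbelian

/-! ### Categories whose modules have bounded global dimension and large dominant dimension -/

section Bounded

variable {C : Type u} [Category.{v} C] [Preadditive C] {A : Type u'} [Category.{v'} A] [Abelian A]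
  (y : C ⥤ A) [IsProjectivelyGenerating y] {n : ℕ}

include y in
-- Every weak kernel lowers the projective dimension by one. Once it is at most `2`, the kernel of
-- `y.map f` is projective, hence representable, so `f` has a genuine kernel in `C`.
lemma hasKernelSeq [IsIdempotentComplete C] (d : ℕ) {X Y : C} (f : X ⟶ Y)
    (h : HasProjectiveDimensionLT (cokernel (y.map f)) (d + 3)) : HasKernelSeq (d + 1) f := by
  induction d generalizing X Y with
  | zero =>
    obtain ⟨K, g, hg⟩ := hasWeakKernels y f
    have hs := hg.isShortExact y
    have hs' := IsShortExact.of_epi (cokernel.π (y.map g))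
    have h₁ : HasProjectiveDimensionLT (cokernel (y.map g)) 2 :=
      hs.2.hasProjectiveDimensionLT_X₁ 2 (inferInstanceAs (HasProjectiveDimensionLT (y.obj Y) 2)) h
    have h₂ : HasProjectiveDimensionLT (kernel (cokernel.π (y.map g))) 1 :=
      hs'.2.hasProjectiveDimensionLT_X₁ 1
        (inferInstanceAs (HasProjectiveDimensionLT (y.obj X) 1)) h₁
    obtain ⟨L, ⟨e⟩⟩ := exists_iso_of_projective y (kernel (cokernel.π (y.map g)))
    obtain ⟨k, hk⟩ := y.map_surjective (e.inv ≫ kernel.ι (cokernel.π (y.map g)))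
    have hk' : Mono (y.map k) := by rw [hk]; infer_instance
    have := hs.mono
    refine ⟨L, k, ⟨y.map_injective ?_, fun {W} a ha => ?_⟩, y.mono_of_mono_map hk'⟩
    · rw [y.map_comp, hk, ← cokernel.π_desc (y.map g) (y.map f)
        (by rw [← y.map_comp, hg.zero, y.map_zero]), Category.assoc, kernel.condition_assoc,
        zero_comp, comp_zero, y.map_zero]
    · have h₀ : y.map a ≫ cokernel.π (y.map g) = 0 := by
        rw [← cancel_mono (cokernelDesc y hg.zero), Category.assoc, cokernel.π_desc, ← y.map_comp,
          ha, y.map_zero, zero_comp]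
      obtain ⟨b, hb⟩ := y.map_surjective (kernel.lift _ (y.map a) h₀ ≫ e.hom)
      exact ⟨b, y.map_injective (by simp [hb, hk])⟩
  | succ d ih =>
    obtain ⟨K, g, hg⟩ := hasWeakKernels y f
    exact ⟨K, g, hg, ih g ((hg.isShortExact y).2.hasProjectiveDimensionLT_X₁ (d + 3)
      (hasProjectiveDimensionLT_of_ge (y.obj Y) 1 _ (by omega)) h)⟩

/-- If `G` has projective dimension at most `d`, then evaluating `G` at a sequence of weak
cokernels gives a sequence that is exact from the degree `d + 1` on. -/
lemma exists_desc_of_hasProjectiveDimensionLT [IsIdempotentComplete C] {Z : ℕ → C}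
    {a : ∀ i, Z i ⟶ Z (i + 1)} (ha : ∀ i, IsWeakCokernel (a i) (a (i + 1))) (d : ℕ) (G : A)
    (hG : HasProjectiveDimensionLT G (d + 1)) (i : ℕ) (hi : d ≤ i) (x : y.obj (Z (i + 1)) ⟶ G)
    (hx : y.map (a i) ≫ x = 0) : ∃ z : y.obj (Z (i + 2)) ⟶ G, y.map (a (i + 1)) ≫ z = x := by
  induction d generalizing G i with
  | zero =>
    have : Projective G := projective_iff_hasProjectiveDimensionLT_one.2 hG
    obtain ⟨W, ⟨e⟩⟩ := exists_iso_of_projective y G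
    obtain ⟨b, hb⟩ := y.map_surjective (x ≫ e.hom)
    obtain ⟨c, hc⟩ := (ha i).exists_desc b (y.map_injective (by
      rw [y.map_comp, hb, reassoc_of% hx, zero_comp, y.map_zero]))
    exact ⟨y.map c ≫ e.inv, by rw [← y.map_comp_assoc, hc, hb, Category.assoc, e.hom_inv_id,
      Category.comp_id]⟩
  | succ d ih =>
    obtain ⟨i, rfl⟩ := Nat.exists_eq_add_of_le' (show 1 ≤ i by omega)
    obtain ⟨W, p, _⟩ := IsProjectivelyGenerating.exists_epi (y := y) G
    have hp := IsShortExact.of_epi p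
    have hK := hp.2.hasProjectiveDimensionLT_X₁ (d + 1)
      (hasProjectiveDimensionLT_of_ge (y.obj W) 1 _ (by omega)) hG
    obtain ⟨u, hu⟩ := y.map_surjective (Projective.factorThru x p)
    have hu' : y.map u ≫ p = x := by rw [hu, Projective.factorThru_comp]
    -- The lift `u` of `x` fails to be killed by `a (i + 1)` only by a morphism into the kernel of
    -- `p`. The induction hypothesis for this kernel provides a correction `w` with `w ≫ p = 0`
    -- under `y`, and `u - w` factors through the next arrow.
    obtain ⟨v₀, hv₀⟩ := hp.exists_lift (y.map (a (i + 1) ≫ u)) (by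
      rw [y.map_comp, Category.assoc, hu', hx])
    obtain ⟨v, hv⟩ := ih _ hK i (by omega) v₀ (by
      rw [← cancel_mono (kernel.ι p), Category.assoc, hv₀, ← y.map_comp, ← Category.assoc,
        (ha i).zero, zero_comp, y.map_zero, zero_comp])
    obtain ⟨w, hw⟩ := y.map_surjective (v ≫ kernel.ι p)
    obtain ⟨t, ht⟩ := (ha (i + 1)).exists_desc (u - w) (y.map_injective (by
      rw [y.map_zero, Preadditive.comp_sub, y.map_sub, y.map_comp _ w, hw, reassoc_of% hv, hv₀,
        sub_self]))
    refine ⟨y.map t ≫ p, ?_⟩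
    rw [← y.map_comp_assoc, ht, y.map_sub, Preadditive.sub_comp, hu', hw, Category.assoc,
      kernel.condition, comp_zero, sub_zero]

lemma HasWeakCokernels.exists_seq (h : HasWeakCokernels C) {X Y : C} (f : X ⟶ Y) :
    ∃ (Z : ℕ → C) (a : ∀ i, Z i ⟶ Z (i + 1)), (∀ i, IsWeakCokernel (a i) (a (i + 1))) ∧
      Nonempty (Arrow.mk (a 0) ≅ Arrow.mk f) := by
  choose Z g hg using h
  let s : ℕ → Arrow C := fun i => Nat.rec (Arrow.mk f) (fun _ φ => Arrow.mk (g φ.hom)) i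
  exact ⟨fun i => (s i).left, fun i => (s i).hom, fun i => hg _, ⟨Iso.refl _⟩⟩

include y in
-- Continue taking weak cokernels indefinitely. The bound on projective dimension makes `a (n + 1)`
-- von Neumann regular, so its kernel is a direct summand `Y'` of `Z (n + 1)`. Replacing `a n` by
-- its component in `Y'` turns it into an epimorphism and ends the sequence.
lemma HasWeakCokernels.exists_isNCokernel [IsIdempotentComplete C] (h : HasWeakCokernels C)
    (hn : 1 ≤ n) (hgl : ∀ G : A, HasProjectiveDimensionLT G (n + 2)) {X Y : C} (f : X ⟶ Y) :
    ∃ S : ComposableArrows C (n + 1),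
      Nonempty (Arrow.mk (S.map' 0 1) ≅ Arrow.mk f) ∧ IsNCokernel S := by
  obtain ⟨Z, a, ha, ⟨e⟩⟩ := h.exists_seq f
  suffices HasCokernelSeq n (a 0) by
    obtain ⟨S, ⟨e'⟩, hS⟩ := HigherAbelian.exists_isNCokernel this
    exact ⟨S, ⟨e' ≪≫ e⟩, hS⟩
  -- Exactness is applied to the projection onto the cokernel of `y.map (a (n + 1))`, which thus
  -- factors through `y.map (a (n + 2))`. Lifting the factorization gives `t` such that `𝟙 _ - a (n
  -- + 2) ≫ t` factors through `a (n + 1)`.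
  obtain ⟨z, hz⟩ := exists_desc_of_hasProjectiveDimensionLT y ha (n + 1) _
    (hgl (cokernel (y.map (a (n + 1))))) (n + 1) le_rfl (cokernel.π _) (cokernel.condition _)
  obtain ⟨t, ht⟩ := y.map_surjective (Projective.factorThru z (cokernel.π (y.map (a (n + 1)))))
  let T := ShortComplex.mk (y.map (a (n + 1))) (cokernel.π _) (cokernel.condition _)
  have hT : T.Exact := ShortComplex.exact_cokernel _
  have h₀ : y.map (𝟙 _ - a (n + 2) ≫ t) ≫ cokernel.π (y.map (a (n + 1))) = 0 := by
    rw [y.map_sub, y.map_id, y.map_comp, ht, Preadditive.sub_comp, Category.id_comp, Category.assoc,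
      Projective.factorThru_comp, hz, sub_self]
  obtain ⟨k, hk⟩ := y.map_surjective (hT.liftFromProjective _ h₀)
  have hk' : k ≫ a (n + 1) = 𝟙 _ - a (n + 2) ≫ t := y.map_injective (by
    rw [y.map_comp, hk]; exact hT.liftFromProjective_comp _ _)
  have haka : a (n + 1) ≫ k ≫ a (n + 1) = a (n + 1) := by
    rw [hk', Preadditive.comp_sub, Category.comp_id, reassoc_of% (ha (n + 1)).zero, zero_comp,
      sub_zero]
  obtain ⟨Y', i, r, hir, hri⟩ := IsIdempotentComplete.idempotents_split (Z (n + 1))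
    (𝟙 _ - a (n + 1) ≫ k) (by
      simp only [Preadditive.comp_sub, Preadditive.sub_comp, Category.comp_id, Category.id_comp,
        Category.assoc, reassoc_of% haka]
      abel)
  have hra : r ≫ i ≫ a (n + 1) = 0 := by
    rw [← Category.assoc, hri, Preadditive.sub_comp, Category.id_comp, Category.assoc, haka,
      sub_self]
  -- If `a n ≫ r ≫ b = 0`, then `r ≫ b` factors through `a (n + 1)`, which `r ≫ i` annihilates; as
  -- `i ≫ r = 𝟙 Y'`, it follows that `b = 0`.
  have hepi : HasCokernelSeq 0 (a n ≫ r) := Preadditive.epi_of_cancel_zero _ fun {W} b hb => by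
    obtain ⟨c, hc⟩ := (ha n).exists_desc (r ≫ b) (by rw [← Category.assoc, hb])
    have : r ≫ i ≫ r ≫ b = 0 := by rw [← hc, reassoc_of% hra, zero_comp]
    rw [reassoc_of% hir] at this
    rw [← Category.id_comp b, ← hir, Category.assoc, this, comp_zero]
  obtain ⟨m, rfl⟩ := Nat.exists_eq_add_of_le' hn
  have hlast : IsWeakCokernel (a m) (a (m + 1) ≫ r) := by
    refine ⟨by rw [reassoc_of% (ha m).zero, zero_comp], fun {W} x hx => ?_⟩
    obtain ⟨b, rfl⟩ := (ha m).exists_desc x hx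
    refine ⟨i ≫ b, ?_⟩
    rw [Category.assoc, ← Category.assoc r, hri, Preadditive.sub_comp, Category.id_comp,
      Preadditive.comp_sub, Category.assoc, reassoc_of% (ha (m + 1)).zero, zero_comp, sub_zero]
  have key : ∀ d j, j + d = m → HasCokernelSeq (d + 1) (a j) := by
    intro d
    induction d with
    | zero =>
      rintro j rfl
      exact ⟨_, _, hlast, hepi⟩
    | succ d ih =>
      intro j hj
      exact ⟨_, _, ha j, ih (j + 1) (by omega)⟩
  exact key m 0 (by omega)

/-- Projective objects are representable, so a torsion object has no nonzero morphism to `J`, hence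
none to its subobject `N`. Higher degrees follow by shifting along the coresolution. -/
lemma IsTorsion.subsingleton_ext [IsIdempotentComplete C] [HasExt.{w} A] {H : A}
    (hH : IsTorsion y H) {k : ℕ} {N : A}
    (hN : HasCoresolution (isProjective A ⊓ isInjective A) k N) (i : ℕ) (hi : i < k) :
    Subsingleton (Ext H N i) := by
  induction k generalizing N i with
  | zero => omega
  | succ k ih =>
    obtain ⟨J, Q, f, p, hfp, hJ, hQ⟩ := hN
    have := hfp.mono
    have : Projective J := hJ.1
    have : Injective J := hJ.2
    obtain _ | i := i
    · obtain ⟨W, ⟨e⟩⟩ := exists_iso_of_projective y J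
      refine subsingleton_ext_zero_iff.2 fun a => ?_
      have := hH (a ≫ f ≫ e.hom)
      exact zero_of_comp_mono _ this
    · exact hfp.subsingleton_ext_of_left (ih hQ i (by omega)) (Ext.subsingleton_of_injective _ _ _)

end Bounded

/-! ### The axioms on monomorphisms and epimorphisms from dominant dimension -/

section Bounded

variable {C : Type u} [Category.{v} C] [Preadditive C] {A : Type u'} [Category.{v'} A] [Abelian A]
  (y : C ⥤ A) [IsProjectivelyGenerating y] {n : ℕ}

lemma isWeakKernel_of_mono {X Y Z : C} {f : X ⟶ Y} {g : Y ⟶ Z} (w : f ≫ g = 0)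
    [Mono (cokernelDesc y w)] : IsWeakKernel f g := by
  refine ⟨w, fun {W} a ha => ?_⟩
  let T := ShortComplex.mk (y.map f) (cokernel.π _) (cokernel.condition _)
  have hT : T.Exact := ShortComplex.exact_cokernel _
  have h₀ : y.map a ≫ cokernel.π (y.map f) = 0 := by
    rw [← cancel_mono (cokernelDesc y w), Category.assoc, cokernel.π_desc, ← y.map_comp, ha,
      y.map_zero, zero_comp]
  obtain ⟨b, hb⟩ := y.map_surjective (hT.liftFromProjective _ h₀)
  refine ⟨b, y.map_injective ?_⟩
  rw [y.map_comp, hb]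
  exact hT.liftFromProjective_comp _ _

/-- Embed `y.obj W` in an injective representable `y.obj V`. The composite into `y.obj V` extends to
the cokernel of `y.map f`, hence factors through `g` and vanishes on the kernel. -/
lemma IsWeakCokernel.isTorsion_kernel_cokernelDesc [IsIdempotentComplete C]
    (hI : ∀ X : C, HasCoresolution (isProjective A ⊓ isInjective A) 1 (y.obj X)) {X Y Z : C}
    {f : X ⟶ Y} {g : Y ⟶ Z} (h : IsWeakCokernel f g) :
    IsTorsion y (kernel (cokernelDesc y h.zero)) := fun W a => by
  obtain ⟨J, Q, i, p, hip, hJ, -⟩ := hI W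
  have := hip.mono
  have : Projective J := hJ.1
  have : Injective J := hJ.2
  obtain ⟨V, ⟨e⟩⟩ := exists_iso_of_projective y J
  have : Injective (y.obj V) := Injective.of_iso e this
  let b := Injective.factorThru (a ≫ i ≫ e.hom) (kernel.ι (cokernelDesc y h.zero))
  have hb : kernel.ι _ ≫ b = a ≫ i ≫ e.hom := Injective.comp_factorThru _ _
  obtain ⟨c, hc, hc'⟩ := exists_map_eq y b
  obtain ⟨d, rfl⟩ := h.exists_desc c hc
  have : b = cokernelDesc y h.zero ≫ y.map d := by
    rw [← cancel_epi (cokernel.π (y.map f)), ← hc', cokernel.π_desc_assoc, y.map_comp]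
  rw [this, kernel.condition_assoc, zero_comp] at hb
  exact zero_of_comp_mono _ hb.symm

/-- Weak kernels are obtained one after another. The kernel of the morphism from the `j`-th cokernel
to the next term is torsion, so it vanishes once torsion objects have no morphism to that cokernel.
This in turn follows from `Ext^i(H, -) = 0` for `i + (j + 1) ≤ n`, a bound that loses one degree
with each short exact sequence. -/
lemma isNKernel_of_mono_of_isNCokernel [IsIdempotentComplete C]
    (hI : ∀ X : C, HasCoresolution (isProjective A ⊓ isInjective A) (n + 1) (y.obj X))
    {S : ComposableArrows C (n + 1)} (hm : Mono (S.map' 0 1)) (hS : IsNCokernel S) :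
    IsNKernel S := by
  let := HasExt.standard A
  have hext {H : A} (hH : IsTorsion y H) (X : C) (i : ℕ) (hi : i ≤ n) :
      Subsingleton (Ext H (y.obj X) i) := hH.subsingleton_ext y (hI X) i (by omega)
  have step (j : ℕ) (hj : j + 1 ≤ n) (h : ∀ H : A, IsTorsion y H → ∀ i, i + (j + 1) ≤ n →
      Subsingleton (Ext H (cokernel (y.map (S.map' j (j + 1)))) i)) :
      IsWeakKernel (S.map' j (j + 1)) (S.map' (j + 1) (j + 2)) := by
    have hw := hS.isWeakCokernel j (by omega)
    have hT := hw.isTorsion_kernel_cokernelDesc y fun X => (hI X).of_le (by omega)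
    have := Preadditive.mono_of_kernel_zero
      (subsingleton_ext_zero_iff.1 (h _ hT 0 (by omega)) (kernel.ι _))
    exact isWeakKernel_of_mono y hw.zero
  have key (j : ℕ) (hj : j + 1 ≤ n) : ∀ H : A, IsTorsion y H → ∀ i, i + (j + 1) ≤ n →
      Subsingleton (Ext H (cokernel (y.map (S.map' j (j + 1)))) i) := by
    induction j with
    | zero =>
      intro H hH i hi
      have : Mono (S.map (homOfLE _ : (⟨0, _⟩ : Fin (n + 2)) ⟶ ⟨1, _⟩)) := hm
      exact (isShortExact_of_mono y _).subsingleton_ext_of_right (hext hH _ i (by omega))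
        (hext hH _ _ (by omega))
    | succ j ih =>
      intro H hH i hi
      exact ((step j (by omega) (ih (by omega))).isShortExact y).subsingleton_ext_of_right
        (hext hH _ i (by omega)) (ih (by omega) H hH (i + 1) (by omega))
  exact isNKernel_mk hm fun i hi => step i (by omega) (key i (by omega))

/-- The last cokernel is torsion, so its `Ext^i` into `y.obj W` vanishes for `i ≤ n`. Shifting back
along the resolution leaves `Ext¹ = 0` for every cokernel with `j ≥ 1`, which is the weak cokernel
property. -/
lemma isNCokernel_of_epi_of_isNKernel [IsIdempotentComplete C]
    (hI : ∀ X : C, HasCoresolution (isProjective A ⊓ isInjective A) (n + 1) (y.obj X))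
    {S : ComposableArrows C (n + 1)} (he : Epi (S.map' n (n + 1))) (hS : IsNKernel S) :
    IsNCokernel S := by
  let := HasExt.standard A
  have key (W : C) (d j : ℕ) (hj : j + d = n) (i : ℕ) (hi : 1 ≤ i) (hij : i ≤ j) :
      Subsingleton (Ext (cokernel (y.map (S.map' j (j + 1)))) (y.obj W) i) := by
    induction d generalizing i j with
    | zero =>
      obtain rfl : j = n := hj
      exact ((isTorsion_cokernel_iff _).2 he).subsingleton_ext y (hI W) i (by omega)
    | succ d ih =>
      refine ((hS.isWeakKernel j (by omega)).isShortExact y).subsingleton_ext_left ?_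
        (ih (j + 1) (by omega) (i + 1) (by omega) (by omega))
      obtain ⟨i, rfl⟩ := Nat.exists_eq_add_of_le' hi
      exact Ext.subsingleton_of_projective _ _ _
  refine isNCokernel_mk he fun i hi => ?_
  have hw := hS.isWeakKernel i hi
  exact ⟨hw.zero, fun {W} a ha => (hw.subsingleton_ext_one_iff y W).1
    (key W (n - (i + 1)) (i + 1) (by omega) 1 le_rfl (by omega)) a ha⟩

lemma isNAbelian_of_hasCoresolution [HasFiniteBiproducts C] [IsIdempotentComplete C] (hn : 1 ≤ n)
    (hC : HasWeakCokernels C) (hgl : ∀ G : A, HasProjectiveDimensionLT G (n + 2))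
    (hI : ∀ X : C, HasCoresolution (isProjective A ⊓ isInjective A) (n + 1) (y.obj X)) :
    IsNAbelian n C where
  exists_nKernel f := by
    obtain ⟨m, rfl⟩ := Nat.exists_eq_add_of_le' hn
    exact exists_isNKernel (hasKernelSeq y m f (hgl _))
  exists_nCokernel f := hC.exists_isNCokernel y hn hgl f
  isNKernel_of_mono _ hm hS := isNKernel_of_mono_of_isNCokernel y hI hm hS
  isNCokernel_of_epi _ he hS := isNCokernel_of_epi_of_isNKernel y hI he hS

include y in
lemma enoughInjectives_of_hasCoresolution [IsIdempotentComplete C]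
    (hI : ∀ X : C, HasCoresolution (isProjective A ⊓ isInjective A) 1 (y.obj X)) :
    EnoughInjectives C where
  presentation X := by
    obtain ⟨J, Q, i, p, hip, hJ, -⟩ := hI X
    have := hip.mono
    have : Projective J := hJ.1
    have : Injective J := hJ.2
    obtain ⟨V, ⟨e⟩⟩ := exists_iso_of_projective y J
    have : Injective (y.obj V) := Injective.of_iso e this
    obtain ⟨f, hf⟩ := y.map_surjective (i ≫ e.hom)
    have : Mono (y.map f) := by rw [hf]; infer_instance
    exact ⟨{ J := V, injective := injective_of_map y, f := f, mono := y.mono_of_mono_map this }⟩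

end Bounded

/-! ### Global and dominant dimension -/

section Dimensions

variable {A : Type u} [Category.{v} A] [Abelian A]

lemma globalDimension_le_iff (n : ℕ) :
    globalDimension A ≤ (n : WithBot ℕ∞) ↔ ∀ G : A, HasProjectiveDimensionLT G (n + 1) := by
  simp only [globalDimension, iSup_le_iff, projectiveDimension_le_iff]

lemma HasProjInjCopresentation.hasCoresolution {X : A} {k : ℕ}
    (h : HasProjInjCopresentation X k) :
    HasCoresolution (isProjective A ⊓ isInjective A) (k + 1) X := by
  obtain ⟨S, ⟨e⟩, hm, hS, hI⟩ := h
  have key : ∀ (d j : ℕ) (hj : j + d = k), HasCoresolution (isProjective A ⊓ isInjective A) d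
      (cokernel (S.map' j (j + 1))) := by
    intro d
    induction d with
    | zero => intros; trivial
    | succ d ih =>
      intro j hj
      have hz : S.map' j (j + 1) ≫ S.map' (j + 1) (j + 2) = 0 := hS.toIsComplex.zero j
      have hj' : (ShortComplex.mk _ _ hz).Exact := hS.exact j
      have : Mono (cokernel.desc _ _ hz) := (ShortComplex.exact_iff_mono_cokernel_desc _).1 hj'
      refine ⟨_, _, cokernel.desc _ _ hz, cokernel.π (S.map' (j + 1) (j + 2)),
        IsShortExact.of_refinements ?_ fun G x hx => ?_, hI (j + 1) (by omega),
        ih (j + 1) (by omega)⟩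
      · rw [← cancel_epi (cokernel.π _), cokernel.π_desc_assoc, cokernel.condition, comp_zero]
      · obtain ⟨G', π, hπ, z, hz'⟩ := ((ShortComplex.exact_cokernel
          (S.map' (j + 1) (j + 2))).exact_up_to_refinements x hx)
        exact ⟨G', π, hπ, z ≫ cokernel.π _, by simpa using hz'⟩
  refine HasCoresolution.of_iso ?_ e.symm
  have h₀ : IsShortExact (S.map' 0 1) (cokernel.π (S.map' 0 1)) := by
    have : Mono (S.map (homOfLE _ : (⟨0, _⟩ : Fin (k + 2)) ⟶ ⟨1, _⟩)) := hm
    exact IsShortExact.of_mono _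
  exact ⟨_, _, _, _, h₀, hI 0 (by omega), key k 0 (by omega)⟩

/-- The arrow `f` is not required to be a monomorphism: the induction splices `p ≫ i`, which is not
one in general, as the next arrow. -/
lemma exists_composableArrows {k : ℕ} {Z J Q : A} {f : Z ⟶ J} {p : J ⟶ Q} (w : f ≫ p = 0)
    (hfp : (ShortComplex.mk f p w).Exact) [Epi p] (hJ : Projective J ∧ Injective J)
    (hQ : HasCoresolution (isProjective A ⊓ isInjective A) k Q) :
    ∃ S : ComposableArrows A (k + 1), Nonempty (Arrow.mk (S.map' 0 1) ≅ Arrow.mk f) ∧ S.Exact ∧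
      ∀ (i : ℕ) (hi : i ≤ k), Projective (S.obj' (i + 1)) ∧ Injective (S.obj' (i + 1)) := by
  induction k generalizing Z J Q with
  | zero =>
    refine ⟨ComposableArrows.mk₁ f, ⟨Iso.refl _⟩, ComposableArrows.exact₁ _, fun i hi => ?_⟩
    obtain rfl : i = 0 := by omega
    exact hJ
  | succ k ih =>
    obtain ⟨J', Q', i, q, hiq, hJ', hQ'⟩ := hQ
    have := hiq.mono
    have := hiq.epi
    have hw₁ : (p ≫ i) ≫ q = 0 := by rw [Category.assoc, hiq.zero, comp_zero]
    have h₁ : (ShortComplex.mk (p ≫ i) q hw₁).Exact := by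
      let φ : ShortComplex.mk (p ≫ i) q hw₁ ⟶ ShortComplex.mk i q hiq.zero :=
        { τ₁ := p, τ₂ := 𝟙 _, τ₃ := 𝟙 _
          comm₁₂ := (Category.comp_id _).symm
          comm₂₃ := (Category.id_comp _).trans (Category.comp_id _).symm }
      have : Epi φ.τ₁ := ‹Epi p›
      have : IsIso φ.τ₂ := inferInstanceAs (IsIso (𝟙 J'))
      have : Mono φ.τ₃ := inferInstanceAs (Mono (𝟙 Q'))
      exact (ShortComplex.exact_iff_of_epi_of_isIso_of_mono φ).2 hiq.2.exact
    obtain ⟨S, ⟨e⟩, hS, hI⟩ := ih _ h₁ hJ' hQ'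
    have hw : (f ≫ e.inv.left) ≫ S.map' 0 1 = 0 := by
      have he : e.inv.left ≫ S.map' 0 1 = (p ≫ i) ≫ e.inv.right := Arrow.w e.inv
      rw [Category.assoc, he, Category.assoc, reassoc_of% w, zero_comp]
    have h₂ : (ShortComplex.mk (f ≫ e.inv.left) (S.map' 0 1) hw).Exact := by
      refine (ShortComplex.exact_iff_exact_up_to_refinements _).2 fun G x hx => ?_
      have hx' : (x ≫ e.hom.left) ≫ p = 0 := by
        have he : e.hom.left ≫ p ≫ i = S.map' 0 1 ≫ e.hom.right := Arrow.w e.hom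
        replace hx : x ≫ S.map' 0 1 = 0 := hx
        rw [← cancel_mono i, Category.assoc, Category.assoc, he, reassoc_of% hx, zero_comp,
          zero_comp]
      obtain ⟨G', π, hπ, z, hz⟩ := hfp.exact_up_to_refinements (x ≫ e.hom.left) hx'
      refine ⟨G', π, hπ, z, ?_⟩
      have hl : e.hom.left ≫ e.inv.left = 𝟙 (S.obj' 0) :=
        congr_arg CommaMorphism.left e.hom_inv_id
      calc π ≫ x = π ≫ x ≫ e.hom.left ≫ e.inv.left := by
            rw [hl]
            exact congr_arg (π ≫ ·) (Category.comp_id x).symm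
        _ = (π ≫ x ≫ e.hom.left) ≫ e.inv.left := by simp only [Category.assoc]
        _ = z ≫ f ≫ e.inv.left := by rw [hz, Category.assoc]
    refine ⟨S.precomp (f ≫ e.inv.left),
      ⟨Arrow.isoMk (Iso.refl _) (Arrow.leftFunc.mapIso e) ?_⟩,
      ComposableArrows.exact_of_δ₀ h₂.exact_toComposableArrows hS, fun j hj => ?_⟩
    · change 𝟙 Z ≫ f = (f ≫ e.inv.left) ≫ e.hom.left
      have hr : e.inv.left ≫ e.hom.left = 𝟙 J := congr_arg CommaMorphism.left e.inv_hom_id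
      rw [Category.assoc, hr, Category.comp_id, Category.id_comp]
    · obtain _ | j := j
      · have e' : J ≅ S.obj' 0 := (Arrow.leftFunc.mapIso e).symm
        obtain ⟨_, _⟩ := hJ
        exact ⟨Projective.of_iso e' ‹_›, Injective.of_iso e' ‹_›⟩
      · exact hI j (by omega)

lemma HasCoresolution.hasProjInjCopresentation {X : A} {k : ℕ}
    (h : HasCoresolution (isProjective A ⊓ isInjective A) (k + 1) X) :
    HasProjInjCopresentation X k := by
  obtain ⟨J, Q, i, p, hip, hJ, hQ⟩ := h
  have := hip.mono
  have := hip.epi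
  obtain ⟨S, ⟨e⟩, hS, hI⟩ := exists_composableArrows _ hip.2.exact hJ hQ
  exact ⟨S, ⟨Arrow.leftFunc.mapIso e⟩,
    ((MorphismProperty.monomorphisms A).arrow_mk_iso_iff e).2 hip.mono, hS, hI⟩

lemma le_dominantDimension_iff (X : A) (n : ℕ) :
    ((n + 1 : ℕ) : ℕ∞) ≤ dominantDimension X ↔
      HasCoresolution (isProjective A ⊓ isInjective A) (n + 1) X := by
  refine ⟨fun h => ?_, fun h => le_sSup ⟨n, rfl, h.hasProjInjCopresentation⟩⟩
  -- The supremum may be infinite and not attained. A member greater than `n` exists in any case,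
  -- and its coresolution can be truncated.
  obtain ⟨_, ⟨k, rfl, hk⟩, hnk⟩ := lt_sSup_iff.1
    (lt_of_lt_of_le (Nat.cast_lt.2 (Nat.lt_succ_self n)) h)
  exact hk.hasCoresolution.of_le (Nat.cast_lt.1 hnk)

variable (A) in
lemma le_dominantDimensionCat_iff (n : ℕ) :
    ((n + 1 : ℕ) : ℕ∞) ≤ dominantDimensionCat A ↔
      ∀ P : A, Projective P → HasCoresolution (isProjective A ⊓ isInjective A) (n + 1) P := by
  refine ⟨fun h P hP => ?_, fun h => le_sSup ⟨n + 1, rfl, fun P hP =>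
    (le_dominantDimension_iff P n).2 (h P hP)⟩⟩
  obtain ⟨_, ⟨k, rfl, hk⟩, hnk⟩ := lt_sSup_iff.1
    (lt_of_lt_of_le (Nat.cast_lt.2 (Nat.lt_succ_self n)) h)
  exact (le_dominantDimension_iff P n).1 (le_trans (Nat.cast_le.2 (Nat.cast_lt.1 hnk)) (hk P hP))

end Dimensions

/-! ### Finitely presented modules -/

section FinitelyPresented

variable {C : Type u} [Category.{v} C]

lemma map_comp_op_apply (F : Cᵒᵖ ⥤ AddCommGrpCat.{v}) {W V Y : C} (g : W ⟶ V) (h : V ⟶ Y)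
    (x : F.obj (op Y)) : F.map (g ≫ h).op x = F.map g.op (F.map h.op x) := by
  rw [op_comp, F.map_comp]
  rfl

variable [Preadditive C]

/-- The morphism from a representable module to an additive functor that corresponds to an
element. -/
def yonedaDesc (F : Cᵒᵖ ⥤ AddCommGrpCat.{v}) [F.Additive] {X : C} (x : F.obj (op X)) :
    preadditiveYoneda.obj X ⟶ F where
  app W := AddCommGrpCat.ofHom
    { toFun := fun g => F.map (Quiver.Hom.op (X := W.unop) (Y := X) g) x
      map_zero' := by
        change F.map (0 : op X ⟶ W) x = 0
        rw [F.map_zero]; rfl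
      map_add' := fun g h => by
        change F.map ((Quiver.Hom.op (X := W.unop) (Y := X) g) +
          (Quiver.Hom.op (X := W.unop) (Y := X) h)) x = _
        rw [F.map_add]; rfl }
  naturality W W' f := by
    ext g
    change F.map (Quiver.Hom.op (X := W.unop) (Y := X) g ≫ f) x = _
    rw [F.map_comp]
    rfl

lemma preadditiveYoneda_obj_map {X W W' : C} (f : W' ⟶ W) (g : W ⟶ X) :
    (preadditiveYoneda.obj X).map f.op g = f ≫ g := rfl

lemma yoneda_app_eq {F : Cᵒᵖ ⥤ AddCommGrpCat.{v}} {X W : C} (p : preadditiveYoneda.obj X ⟶ F)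
    (g : W ⟶ X) : p.app (op W) g = F.map g.op (p.app (op X) (𝟙 X)) := by
  have := NatTrans.naturality_apply p g.op (𝟙 X)
  rw [← this, preadditiveYoneda_obj_map, Category.comp_id]

/-- The element `x` of `F` and the morphism `f` form a presentation of `F`. -/
structure IsPresentation (F : Cᵒᵖ ⥤ AddCommGrpCat.{v}) {X Y : C} (f : X ⟶ Y) (x : F.obj (op Y)) :
    Prop where
  map_eq_zero_iff {W : C} (g : W ⟶ Y) : F.map g.op x = 0 ↔ ∃ h : W ⟶ X, h ≫ f = g
  exists_map_eq {W : C} (t : F.obj (op W)) : ∃ g : W ⟶ Y, F.map g.op x = t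

lemma isFinitelyPresented_iff (F : Cᵒᵖ ⥤ AddCommGrpCat.{v}) :
    isFinitelyPresented C F ↔ F.Additive ∧
      ∃ (X Y : C) (f : X ⟶ Y) (x : F.obj (op Y)), IsPresentation F f x := by
  refine and_congr_right fun _ => ⟨?_, ?_⟩
  · rintro ⟨X, Y, f, p, h⟩
    refine ⟨X, Y, f, p.app (op Y) (𝟙 Y), fun {W} g => ?_, fun {W} t => ?_⟩
    · rw [← yoneda_app_eq]
      exact (h (op W)).1 g
    · obtain ⟨g, hg⟩ := (h (op W)).2 t
      exact ⟨g, (yoneda_app_eq p g).symm.trans hg⟩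
  · rintro ⟨X, Y, f, x, h⟩
    exact ⟨X, Y, f, yonedaDesc F x, fun W => ⟨fun g => h.map_eq_zero_iff g, fun t =>
      h.exists_map_eq t⟩⟩

lemma map_add_op_apply (F : Cᵒᵖ ⥤ AddCommGrpCat.{v}) [F.Additive] {W Y : C} (g h : W ⟶ Y)
    (x : F.obj (op Y)) : F.map (g + h).op x = F.map g.op x + F.map h.op x := by
  rw [op_add, F.map_add]
  rfl

lemma map_sub_op_apply (F : Cᵒᵖ ⥤ AddCommGrpCat.{v}) [F.Additive] {W Y : C} (g h : W ⟶ Y)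
    (x : F.obj (op Y)) : F.map (g - h).op x = F.map g.op x - F.map h.op x := by
  rw [eq_sub_iff_add_eq, ← map_add_op_apply, sub_add_cancel]

lemma additive_of_surjective {F G : Cᵒᵖ ⥤ AddCommGrpCat.{v}} [F.Additive] (φ : F ⟶ G)
    (h : ∀ W, Function.Surjective (φ.app W)) : G.Additive where
  map_add {V W f g} := by
    ext t
    obtain ⟨s, rfl⟩ := h V t
    change G.map (f + g) (φ.app V s) = G.map f (φ.app V s) + G.map g (φ.app V s)
    simp only [← NatTrans.naturality_apply]
    rw [← map_add, F.map_add]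
    rfl

lemma additive_of_injective {F G : Cᵒᵖ ⥤ AddCommGrpCat.{v}} [G.Additive] (φ : F ⟶ G)
    (h : ∀ W, Function.Injective (φ.app W)) : F.Additive where
  map_add {V W f g} := by
    ext t
    refine h W ?_
    change φ.app W (F.map (f + g) t) = φ.app W (F.map f t + F.map g t)
    rw [map_add]
    simp only [NatTrans.naturality_apply]
    rw [G.map_add]
    rfl

variable [HasBinaryBiproducts C]

/-- The generator of `G` generates `K`; its relations are those of `G` together with `b`, which
represents the image of the generator of `F`. -/
lemma IsPresentation.cokernel {F G K : Cᵒᵖ ⥤ AddCommGrpCat.{v}} [G.Additive] {φ : F ⟶ G}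
    {k : G ⟶ K} (he : ∀ W, Function.Exact (φ.app W) (k.app W))
    (hk : ∀ W, Function.Surjective (k.app W)) {X Y X' Y' : C} {f : X ⟶ Y} {f' : X' ⟶ Y'}
    {x : F.obj (op Y)} {x' : G.obj (op Y')} (hF : IsPresentation F f x)
    (hG : IsPresentation G f' x') {b : Y ⟶ Y'} (hb : G.map b.op x' = φ.app (op Y) x) :
    IsPresentation K (biprod.desc b f') (k.app (op Y') x') where
  map_eq_zero_iff {W} g := by
    rw [← NatTrans.naturality_apply, he]
    constructor
    · rintro ⟨s, hs⟩
      obtain ⟨a, rfl⟩ := hF.exists_map_eq s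
      rw [NatTrans.naturality_apply, ← hb, ← map_comp_op_apply] at hs
      obtain ⟨h, hh⟩ := (hG.map_eq_zero_iff (g - a ≫ b)).1 (by
        rw [map_sub_op_apply, hs, sub_self])
      exact ⟨biprod.lift a h, by rw [biprod.lift_desc, hh, add_sub_cancel]⟩
    · rintro ⟨h, rfl⟩
      refine ⟨F.map (h ≫ biprod.fst).op x, ?_⟩
      have : G.map ((h ≫ biprod.snd) ≫ f').op x' = 0 := (hG.map_eq_zero_iff _).2 ⟨_, rfl⟩
      rw [NatTrans.naturality_apply, ← hb, ← map_comp_op_apply, biprod.desc_eq,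
        Preadditive.comp_add, map_add_op_apply, ← Category.assoc h biprod.snd, this, add_zero,
        Category.assoc]
  exists_map_eq {W} t := by
    obtain ⟨s, rfl⟩ := hk _ t
    obtain ⟨g, rfl⟩ := hG.exists_map_eq s
    exact ⟨g, (NatTrans.naturality_apply _ _ _).symm⟩

lemma isFinitelyPresented_of_cokernel {F G K : Cᵒᵖ ⥤ AddCommGrpCat.{v}} {φ : F ⟶ G} {k : G ⟶ K}
    (he : ∀ W, Function.Exact (φ.app W) (k.app W)) (hk : ∀ W, Function.Surjective (k.app W))
    (hF : isFinitelyPresented C F) (hG : isFinitelyPresented C G) : isFinitelyPresented C K := by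
  rw [isFinitelyPresented_iff] at hF hG ⊢
  obtain ⟨_, X, Y, f, x, hF⟩ := hF
  obtain ⟨_, X', Y', f', x', hG⟩ := hG
  obtain ⟨b, hb⟩ := hG.exists_map_eq (φ.app (op Y) x)
  exact ⟨additive_of_surjective k hk, _, _, _, _, hF.cokernel he hk hG hb⟩

lemma HasWeakKernels.exists_weakPullback (hC : HasWeakKernels C) {X Y Z : C} (f : X ⟶ Z)
    (g : Y ⟶ Z) : ∃ (P : C) (p : P ⟶ X) (q : P ⟶ Y), p ≫ f = q ≫ g ∧
      ∀ {W : C} (a : W ⟶ X) (b : W ⟶ Y), a ≫ f = b ≫ g → ∃ c : W ⟶ P, c ≫ p = a ∧ c ≫ q = b := by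
  obtain ⟨P, p, hp⟩ := hC (biprod.desc f (-g))
  refine ⟨P, p ≫ biprod.fst, p ≫ biprod.snd, ?_, fun {W} a b hab => ?_⟩
  · have := hp.zero
    rwa [biprod.desc_eq, Preadditive.comp_add, Preadditive.comp_neg, Preadditive.comp_neg,
      add_neg_eq_zero, ← Category.assoc, ← Category.assoc] at this
  · obtain ⟨c, hc⟩ := hp.exists_lift (biprod.lift a b) (by
      rw [biprod.lift_desc, Preadditive.comp_neg, hab, add_neg_cancel])
    exact ⟨c, by rw [← Category.assoc, hc, biprod.lift_fst],
      by rw [← Category.assoc, hc, biprod.lift_snd]⟩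

/-- Elements of the kernel are morphisms to `Y` that `b` sends into the relations `f'`, so the weak
pullback `Z` of `b` and `f'` covers them. The relations are the weak pullback `Z'` of `p` with the
relations `f` of `F`. -/
lemma isFinitelyPresented_of_kernel (hC : HasWeakKernels C) {K F G : Cᵒᵖ ⥤ AddCommGrpCat.{v}}
    {k : K ⟶ F} {φ : F ⟶ G} (he : ∀ W, Function.Exact (k.app W) (φ.app W))
    (hk : ∀ W, Function.Injective (k.app W)) (hF : isFinitelyPresented C F)
    (hG : isFinitelyPresented C G) : isFinitelyPresented C K := by
  rw [isFinitelyPresented_iff] at hF hG ⊢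
  obtain ⟨_, X, Y, f, x, hF⟩ := hF
  obtain ⟨_, X', Y', f', x', hG⟩ := hG
  obtain ⟨b, hb⟩ := hG.exists_map_eq (φ.app (op Y) x)
  obtain ⟨Z, p, q, hpq, hZ⟩ := hC.exists_weakPullback b f'
  obtain ⟨Z', p', q', hpq', hZ'⟩ := hC.exists_weakPullback p f
  have hφ {W : C} (a : W ⟶ Y) : φ.app (op W) (F.map a.op x) = G.map (a ≫ b).op x' := by
    rw [NatTrans.naturality_apply, ← hb, ← map_comp_op_apply]
  obtain ⟨z, hz⟩ := (he _ _).1 ((hφ p).trans ((hG.map_eq_zero_iff _).2 ⟨q, hpq.symm⟩))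
  have hzk {W : C} (a : W ⟶ Z) : k.app (op W) (K.map a.op z) = F.map (a ≫ p).op x := by
    rw [NatTrans.naturality_apply, hz, ← map_comp_op_apply]
  refine ⟨additive_of_injective k hk, Z', Z, p', z, fun {W} g => ?_, fun {W} t => ?_⟩
  · rw [← map_eq_zero_iff _ (hk _), hzk, hF.map_eq_zero_iff]
    constructor
    · rintro ⟨h, hh⟩
      obtain ⟨c, hc, -⟩ := hZ' g h hh.symm
      exact ⟨c, hc⟩
    · rintro ⟨h, rfl⟩
      exact ⟨h ≫ q', by rw [Category.assoc, Category.assoc, hpq']⟩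
  · obtain ⟨g, hg⟩ := hF.exists_map_eq (k.app _ t)
    have h₀ : G.map (g ≫ b).op x' = 0 := by
      rw [← hφ, hg]
      exact (he _ _).2 ⟨t, rfl⟩
    obtain ⟨h, hh⟩ := (hG.map_eq_zero_iff _).1 h₀
    obtain ⟨c, hc, -⟩ := hZ g h hh.symm
    exact ⟨c, hk _ (by rw [hzk, hc, hg])⟩

lemma isFinitelyPresented_of_product {F G K : Cᵒᵖ ⥤ AddCommGrpCat.{v}} {p : K ⟶ F} {q : K ⟶ G}
    (h : ∀ W, Function.Bijective fun t => (p.app W t, q.app W t))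
    (hF : isFinitelyPresented C F) (hG : isFinitelyPresented C G) : isFinitelyPresented C K := by
  rw [isFinitelyPresented_iff] at hF hG ⊢
  obtain ⟨_, X, Y, f, x, hF⟩ := hF
  obtain ⟨_, X', Y', f', x', hG⟩ := hG
  obtain ⟨z, hz⟩ := (h _).2 (F.map (biprod.fst (X := Y) (Y := Y')).op x,
    G.map (biprod.snd (X := Y) (Y := Y')).op x')
  obtain ⟨hz₁, hz₂⟩ := Prod.ext_iff.1 hz
  dsimp at hz₁ hz₂
  have hp {W : C} (g : W ⟶ Y ⊞ Y') : p.app (op W) (K.map g.op z) = F.map (g ≫ biprod.fst).op x := by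
    rw [NatTrans.naturality_apply, hz₁, map_comp_op_apply]
  have hq {W : C} (g : W ⟶ Y ⊞ Y') :
      q.app (op W) (K.map g.op z) = G.map (g ≫ biprod.snd).op x' := by
    rw [NatTrans.naturality_apply, hz₂, map_comp_op_apply]
  refine ⟨⟨fun {V W f g} => ?_⟩, X ⊞ X', Y ⊞ Y', biprod.map f f', z, fun {W} g => ?_,
    fun {W} t => ?_⟩
  · ext t
    refine (h W).1 (Prod.ext ?_ ?_)
    · change p.app W (K.map (f + g) t) = p.app W (K.map f t + K.map g t)
      rw [map_add]
      simp only [NatTrans.naturality_apply]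
      rw [F.map_add]
      rfl
    · change q.app W (K.map (f + g) t) = q.app W (K.map f t + K.map g t)
      rw [map_add]
      simp only [NatTrans.naturality_apply]
      rw [G.map_add]
      rfl
  · have : K.map g.op z = 0 ↔
        F.map (g ≫ biprod.fst).op x = 0 ∧ G.map (g ≫ biprod.snd).op x' = 0 := by
      rw [← hp, ← hq]
      refine ⟨fun h => by simp [h], fun h' => (h _).1 (Prod.ext ?_ ?_)⟩
      · simpa using h'.1
      · simpa using h'.2
    rw [this, hF.map_eq_zero_iff, hG.map_eq_zero_iff]
    constructor
    · rintro ⟨⟨a, ha⟩, ⟨b, hb⟩⟩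
      exact ⟨biprod.lift a b, by ext <;> simp [ha, hb]⟩
    · rintro ⟨a, rfl⟩
      exact ⟨⟨a ≫ biprod.fst, by simp⟩, ⟨a ≫ biprod.snd, by simp⟩⟩
  · obtain ⟨a, ha⟩ := hF.exists_map_eq (p.app _ t)
    obtain ⟨b, hb⟩ := hG.exists_map_eq (q.app _ t)
    refine ⟨biprod.lift a b, (h _).1 (Prod.ext ?_ ?_)⟩
    · change p.app _ _ = _
      rw [hp, biprod.lift_fst, ha]
    · change q.app _ _ = _
      rw [hq, biprod.lift_snd, hb]

end FinitelyPresented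

/-! ### The abelian category of finitely presented modules and its Yoneda embedding -/

section FpMod

variable {C : Type u} [Category.{v} C]

lemma surjective_app_of_epi {F G : Cᵒᵖ ⥤ AddCommGrpCat.{v}} (φ : F ⟶ G) [Epi φ] (W : Cᵒᵖ) :
    Function.Surjective (φ.app W) :=
  (AddCommGrpCat.epi_iff_surjective _).1 inferInstance

lemma injective_app_of_mono {F G : Cᵒᵖ ⥤ AddCommGrpCat.{v}} (φ : F ⟶ G) [Mono φ] (W : Cᵒᵖ) :
    Function.Injective (φ.app W) :=
  (AddCommGrpCat.mono_iff_injective _).1 inferInstance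

lemma exact_app {S : ShortComplex (Cᵒᵖ ⥤ AddCommGrpCat.{v})} (hS : S.Exact) (W : Cᵒᵖ) :
    Function.Exact (S.f.app W) (S.g.app W) :=
  (ShortComplex.ab_exact_iff_function_exact _).1 (hS.map ((evaluation _ _).obj W))

variable [Preadditive C]

lemma isFinitelyPresented_yoneda (X : C) : isFinitelyPresented C (preadditiveYoneda.obj X) :=
  (isFinitelyPresented_iff _).2 ⟨inferInstance, X, X, 0, 𝟙 X, fun {W} g => by
    rw [preadditiveYoneda_obj_map, Category.comp_id]
    constructor
    · rintro rfl
      exact ⟨0, comp_zero⟩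
    · rintro ⟨_, rfl⟩
      exact comp_zero, fun {W} t => ⟨t, Category.comp_id _⟩⟩

variable [HasBinaryBiproducts C]

instance : (isFinitelyPresented C).IsClosedUnderCokernels where
  cokernels_le := by
    rintro _ ⟨f, k, hk, hf⟩
    have : Epi k.π := Cofork.IsColimit.epi hk
    exact isFinitelyPresented_of_cokernel (φ := f) (k := k.π)
      (exact_app (ShortComplex.exact_of_g_is_cokernel (.mk f k.π k.condition)
        (IsColimit.ofIsoColimit hk (Cofork.ext (Iso.refl _)))))
      (surjective_app_of_epi k.π) hf.1 hf.2

lemma isClosedUnderKernels_isFinitelyPresented (hC : HasWeakKernels C) :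
    (isFinitelyPresented C).IsClosedUnderKernels where
  kernels_le := by
    rintro _ ⟨f, k, hk, hf⟩
    have : Mono k.ι := Fork.IsLimit.mono hk
    exact isFinitelyPresented_of_kernel hC (φ := f) (k := k.ι)
      (exact_app (ShortComplex.exact_of_f_is_kernel (.mk k.ι f k.condition)
        (IsLimit.ofIsoLimit hk (Fork.ext (Iso.refl _)))))
      (injective_app_of_mono k.ι) hf.1 hf.2

instance : (isFinitelyPresented C).IsClosedUnderIsomorphisms where
  of_iso {F G} e hF := by
    refine isFinitelyPresented_of_cokernel (φ := (0 : F ⟶ F)) (k := e.hom)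
      (exact_app (S := ShortComplex.mk 0 e.hom zero_comp) ?_) (surjective_app_of_epi e.hom) hF hF
    exact (ShortComplex.exact_iff_mono _ rfl).2 inferInstance

instance [HasZeroObject C] : (isFinitelyPresented C).ContainsZero where
  exists_zero := by
    obtain ⟨Z, hZ⟩ := HasZeroObject.zero (C := C)
    refine ⟨_, (IsZero.iff_id_eq_zero _).2 ?_, isFinitelyPresented_yoneda Z⟩
    rw [← preadditiveYoneda.map_id, hZ.eq_of_src (𝟙 _) 0]
    ext W g
    exact comp_zero

instance : (isFinitelyPresented C).IsClosedUnderBinaryProducts where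
  limitsOfShape_le := by
    rintro K ⟨p⟩
    let F := p.diag.obj ⟨.left⟩
    let G := p.diag.obj ⟨.right⟩
    have e : K ≅ F ⊞ G :=
      p.isLimit.conePointsIsoOfNatIso (BinaryBiproduct.isLimit F G) (diagramIsoPair p.diag)
    refine (isFinitelyPresented C).prop_of_iso e.symm
      (isFinitelyPresented_of_product (p := biprod.fst (X := F) (Y := G)) (q := biprod.snd)
        (fun W => ⟨fun s t hst => ?_, fun ⟨s, t⟩ => ?_⟩)
        (p.prop_diag_obj _) (p.prop_diag_obj _))
    · have key (u : (F ⊞ G).obj W) :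
          u = (biprod.inl : F ⟶ F ⊞ G).app W ((biprod.fst : F ⊞ G ⟶ F).app W u) +
          (biprod.inr : G ⟶ F ⊞ G).app W ((biprod.snd : F ⊞ G ⟶ G).app W u) :=
        ConcreteCategory.congr_hom (NatTrans.congr_app (biprod.total (X := F) (Y := G)).symm W) u
      obtain ⟨h₁, h₂⟩ := Prod.ext_iff.1 hst
      dsimp only at h₁ h₂
      rw [key s, key t, h₁, h₂]
    · have h₁ := ConcreteCategory.congr_hom
        (NatTrans.congr_app (biprod.inl_fst (X := F) (Y := G)) W) s
      have h₂ := ConcreteCategory.congr_hom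
        (NatTrans.congr_app (biprod.inl_snd (X := F) (Y := G)) W) s
      have h₃ := ConcreteCategory.congr_hom
        (NatTrans.congr_app (biprod.inr_fst (X := F) (Y := G)) W) t
      have h₄ := ConcreteCategory.congr_hom
        (NatTrans.congr_app (biprod.inr_snd (X := F) (Y := G)) W) t
      refine ⟨(biprod.inl : F ⟶ F ⊞ G).app W s + (biprod.inr : G ⟶ F ⊞ G).app W t, Prod.ext ?_ ?_⟩
      · dsimp only
        rw [map_add]
        exact (congr_arg₂ (· + ·) h₁ h₃).trans (add_zero s)
      · dsimp only
        rw [map_add]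
        exact (congr_arg₂ (· + ·) h₂ h₄).trans (zero_add t)

section

variable [HasZeroObject C]

instance : (isFinitelyPresented C).IsClosedUnderFiniteProducts :=
  ObjectProperty.IsClosedUnderFiniteProducts.mk'

lemma HasWeakKernels.rightCoherent (hC : HasWeakKernels C) : RightCoherent C where
  isAbelian := by
    have := isClosedUnderKernels_isFinitelyPresented hC
    exact { }

end

variable (C) in
/-- The Yoneda embedding of `C` into the category of finitely presented modules. -/
noncomputable abbrev fpYoneda : C ⥤ FpMod C :=
  (isFinitelyPresented C).lift preadditiveYoneda isFinitelyPresented_yoneda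

instance [HasZeroObject C] [RightCoherent C] : IsProjectivelyGenerating (fpYoneda C) where
  map_add {X Y f g} := by
    ext W h
    exact Preadditive.comp_add _ _ _ h f g
  map_surjective := (inferInstance : (fpYoneda C).Full).map_surjective
  map_injective h := (inferInstance : (fpYoneda C).Faithful).map_injective h
  projective X := ⟨fun {F G} f e he => by
    -- The inclusion into all functors preserves epimorphisms, so `e` is componentwise surjective
    -- and the element of `G` corresponding to `f` lifts to `F`.
    have := (isFinitelyPresented C).preservesEpimorphisms_ι_of_isNormalMonoCategory
    have : Epi e.hom := inferInstanceAs (Epi ((isFinitelyPresented C).ι.map e))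
    obtain ⟨s, hs⟩ := surjective_app_of_epi e.hom (op X) (f.hom.app (op X) (𝟙 X))
    have := F.property.1
    refine ⟨ObjectProperty.homMk (yonedaDesc F.obj s), ?_⟩
    ext W g
    change e.hom.app W (F.obj.map (Quiver.Hom.op g) s) = f.hom.app W g
    rw [NatTrans.naturality_apply, hs]
    exact (yoneda_app_eq f.hom g).symm⟩
  exists_epi G := by
    obtain ⟨-, X, Y, f, p, h⟩ := G.property
    have : Epi p := by
      have (W : Cᵒᵖ) : Epi (p.app W) := (AddCommGrpCat.epi_iff_surjective _).2 (h W).2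
      exact NatTrans.epi_of_epi_app p
    exact ⟨Y, ObjectProperty.homMk p, (isFinitelyPresented C).ι.epi_of_epi_map this⟩

lemma RightCoherent.hasWeakKernels [HasZeroObject C] [RightCoherent C] : HasWeakKernels C :=
  HigherAbelian.hasWeakKernels (fpYoneda C)

end FpMod

/-! ### Coherence in terms of weak kernels, and duality -/

section Main

variable {C : Type u} [Category.{v} C]

lemma enoughInjectives_op_iff : EnoughInjectives Cᵒᵖ ↔ EnoughProjectives C :=
  ⟨fun _ => Injective.enoughProjectives_of_enoughInjectives_op, fun _ => inferInstance⟩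

variable [Preadditive C] {n : ℕ}

lemma IsNAbelian.hasWeakCokernels (hn : 1 ≤ n) (hC : IsNAbelian n C) : HasWeakCokernels C :=
  fun X Y f => by
    obtain ⟨S, ⟨e⟩, hS⟩ := hC.exists_nCokernel f
    have h := hS.isWeakCokernel 0 (by omega)
    have h₁ : e.inv.left ≫ S.map' 0 1 = f ≫ e.inv.right := Arrow.w e.inv
    have h₂ : e.hom.left ≫ f = S.map' 0 1 ≫ e.hom.right := Arrow.w e.hom
    have h₃ : e.inv.right ≫ e.hom.right = 𝟙 Y := congr_arg CommaMorphism.right e.inv_hom_id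
    refine ⟨_, e.inv.right ≫ S.map' 1 2, ?_, fun {W} a ha => ?_⟩
    · rw [← Category.assoc, ← h₁, Category.assoc]
      exact (congr_arg (e.inv.left ≫ ·) h.zero).trans comp_zero
    · obtain ⟨b, hb⟩ := h.exists_desc (e.hom.right ≫ a) (by
        rw [← Category.assoc, ← h₂, Category.assoc, ha, comp_zero])
      refine ⟨b, ?_⟩
      rw [Category.assoc, hb, ← Category.assoc, h₃, Category.id_comp]

lemma IsNAbelian.hasWeakKernels (hn : 1 ≤ n) (hC : IsNAbelian n C) : HasWeakKernels C :=
  (hC.op.hasWeakCokernels hn).unop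

variable [HasFiniteBiproducts C]

lemma rightCoherent_iff : RightCoherent C ↔ HasWeakKernels C :=
  have := HasBinaryBiproducts.of_hasBinaryProducts (C := C)
  ⟨fun _ => RightCoherent.hasWeakKernels, fun h => h.rightCoherent⟩

lemma leftCoherent_iff : LeftCoherent C ↔ HasWeakCokernels C := by
  have := hasFiniteBiproducts_op (C := C)
  exact rightCoherent_iff.trans ⟨fun h => h.unop, fun h => h.op⟩

lemma IsNAbelian.rightCoherent (hn : 1 ≤ n) (hC : IsNAbelian n C) : RightCoherent C :=
  rightCoherent_iff.2 (hC.hasWeakKernels hn)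

lemma IsNAbelian.enoughInjectives_fpMod (hn : 1 ≤ n) (hC : IsNAbelian n C)
    [EnoughInjectives C] : EnoughInjectives (FpMod C) := by
  have := HasBinaryBiproducts.of_hasBinaryProducts (C := C)
  have := hC.rightCoherent hn
  exact hC.enoughInjectives_of_isProjectivelyGenerating (fpYoneda C) hn

lemma isNAbelian_and_enoughInjectives_iff [IsIdempotentComplete C] (hn : 1 ≤ n) :
    (IsNAbelian n C ∧ EnoughInjectives C) ↔ ∃ (_ : RightCoherent C) (_ : LeftCoherent C),
      globalDimension (FpMod C) ≤ ((n + 1 : ℕ) : WithBot ℕ∞) ∧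
      ((n + 1 : ℕ) : ℕ∞) ≤ dominantDimensionCat (FpMod C) := by
  have := HasBinaryBiproducts.of_hasBinaryProducts (C := C)
  constructor
  · rintro ⟨hC, _⟩
    have := hC.rightCoherent hn
    refine ⟨this, leftCoherent_iff.2 (hC.hasWeakCokernels hn),
      (globalDimension_le_iff _).2 (hC.hasProjectiveDimensionLT (fpYoneda C)),
      (le_dominantDimensionCat_iff _ _).2 fun P _ => ?_⟩
    obtain ⟨X, ⟨e⟩⟩ := exists_iso_of_projective (fpYoneda C) P
    exact (hC.hasCoresolution (fpYoneda C) hn (n + 1) le_rfl X).of_iso e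
  · rintro ⟨_, hC, hgl, hdom⟩
    have hI (X : C) := (le_dominantDimensionCat_iff _ _).1 hdom ((fpYoneda C).obj X) inferInstance
    exact ⟨isNAbelian_of_hasCoresolution (fpYoneda C) hn (leftCoherent_iff.1 hC)
      ((globalDimension_le_iff _).1 hgl) hI,
      enoughInjectives_of_hasCoresolution (fpYoneda C) fun X => (hI X).of_le (by omega)⟩

lemma isNAbelian_op_iff [IsIdempotentComplete C] : IsNAbelian n Cᵒᵖ ↔ IsNAbelian n C :=
  ⟨fun h => h.unop, fun h => h.op⟩

/-- Passing through weak kernels avoids a comparison of modules over `Cᵒᵖᵒᵖ` with modules over `C`.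
-/
lemma leftCoherent_op_iff : LeftCoherent Cᵒᵖ ↔ RightCoherent C := by
  have := hasFiniteBiproducts_op (C := C)
  exact leftCoherent_iff.trans <| Iff.trans ⟨fun h => h.unop, fun h => h.op⟩
    rightCoherent_iff.symm

end Main

end HigherAbelian

theorem theorem12 (n : ℕ) (hn : 1 ≤ n) (C : Type u) [Category.{v} C] [Preadditive C]
    [HasFiniteBiproducts C] [IsIdempotentComplete C] :
    ((HigherAbelian.IsNAbelian n C ∧ EnoughInjectives C) ↔
      ∃ (_ : HigherAbelian.RightCoherent C) (_ : HigherAbelian.LeftCoherent C),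
        HigherAbelian.globalDimension (HigherAbelian.FpMod C) ≤ ((n + 1 : ℕ) : WithBot ℕ∞) ∧
        ((n + 1 : ℕ) : ℕ∞) ≤ HigherAbelian.dominantDimensionCat (HigherAbelian.FpMod C)) ∧
    (HigherAbelian.IsNAbelian n C ∧ EnoughInjectives C →
      EnoughInjectives (HigherAbelian.FpMod C)) ∧
    ((HigherAbelian.IsNAbelian n C ∧ EnoughProjectives C) ↔
      ∃ (_ : HigherAbelian.RightCoherent C) (_ : HigherAbelian.LeftCoherent C),
        HigherAbelian.globalDimension (HigherAbelian.FpMod Cᵒᵖ) ≤ ((n + 1 : ℕ) : WithBot ℕ∞) ∧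
        ((n + 1 : ℕ) : ℕ∞) ≤ HigherAbelian.dominantDimensionCat (HigherAbelian.FpMod Cᵒᵖ)) ∧
    (HigherAbelian.IsNAbelian n C ∧ EnoughProjectives C →
      EnoughInjectives (HigherAbelian.FpMod Cᵒᵖ)) := by
  have := HigherAbelian.hasFiniteBiproducts_op (C := C)
  refine ⟨HigherAbelian.isNAbelian_and_enoughInjectives_iff hn,
    fun ⟨hC, _⟩ => hC.enoughInjectives_fpMod hn, ?_,
    fun ⟨hC, _⟩ => hC.op.enoughInjectives_fpMod hn⟩
  -- The statement for projectives is the one for injectives in `Cᵒᵖ`, with the two coherence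
  -- conditions exchanged.
  rw [← HigherAbelian.isNAbelian_op_iff, ← HigherAbelian.enoughInjectives_op_iff,
    HigherAbelian.isNAbelian_and_enoughInjectives_iff hn]
  exact ⟨fun ⟨hr, hl, h⟩ => ⟨HigherAbelian.leftCoherent_op_iff.1 hl, hr, h⟩,
    fun ⟨hr, hl, h⟩ => ⟨hl, HigherAbelian.leftCoherent_op_iff.2 hr, h⟩⟩
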